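/- Let $n\ge 2$, let $p\in\{1,\dots,n-1\}$ be coprime to $n$, and let $q\in\{1,\dots,n-1\}$ satisfy $pq\equiv 1 \pmod n$. Let $y$ be a type (i) coupling, that is $$\Big(\frac pn-\frac1{nq}\Big)\pi<y<\frac{p\pi}n\qquad\text{or}\qquad \frac{p\pi}n<y<\Big(\frac pn+\frac1{(n-q)n}\Big)\pi ,$$ and put $M=p\pi-ny\neq0$. In the hyperplane $\{\xi\in\mathbb R^n:\xi_1+\dots+\xi_n=\pi\}$, with coordinates $\xi_1,\dots,\xi_{n-1}$ and with indices read modulo $n$, let $$\mathcal A_y=\{\xi:\ \operatorname{sgn}(M)(\xi_j+\dots+\xi_{j+p-1}-y)\ge0,\ j=1,\dots,n\},$$ and let $\mathcal A_y^+$ be its interior. Equip the manifold $P=\mathcal A_y^+\times\mathbb T^{n-1}$, with points $(\xi,e^{i\theta})$, with the form $\omega^{\rm loc}=\sum_{k=1}^{n-1}d\theta_k\wedge d\xi_k$. Let $A\in\mathbb Z^{(n-1)\times(n-1)}$ be the coefficient matrix of $\xi_1,\dots,\xi_{n-1}$ in the sums $\xi_j+\dots+\xi_{j+p-1}$ $(1\le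 j\le n-1)$ after substituting $\xi_n=\pi-\xi_1-\dots-\xi_{n-1}$; thus $A_{j,k}=1$ if $j\le n-p$ and $j\le k<j+p$, $A_{j,k}=-1$ if $j>n-p$ and $j+p-n\le k<j$, and $A_{j,k}=0$ otherwise. Let $\Omega=(A^{-1})^{\top}$, which is an integer matrix. Define $\mathcal E\colon P\to\mathbb C^n$, $(\xi,e^{i\theta})\mapsto u$, by $$u_j=\sqrt{\operatorname{sgn}(M)(\xi_j+\dots+\xi_{j+p-1}-y)}\;\exp\Big(i\operatorname{sgn}(M)\sum_{k=1}^{n-1}\Omega_{j,k}\theta_k\Big)\ (1\le j\le n-1),\qquad u_n=\sqrt{\operatorname{sgn}(M)(\xi_n+\dots+\xi_{n+p-1}-y)} .$$ Let $\pi_{|M|}\colon S_{|M|}=\{u\in\mathbb C^n:\sum_j|u_j|^2=|M|\}\to\mathbb{CP}^{n-1}$, $u\mapsto[u]$, be the natural projection, and let $\omega_{\rm FS}$ be the Fubini--Study form on $\mathbb{CP}^{n-1}$, given in each affine chart by $i\bar\partial\partial\log(1+|z|^2)$. Then: 1. Every $\xi\in\mathcal A_y$ satisfies $\xi_k>0$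 for all $k=1,\dots,n$. 2. $\mathcal E$ takes its values in $S_{|M|}$. 3. $\pi_{|M|}^*(|M|\omega_{\rm FS})=i\sum_{j=1}^n d\bar u_j\wedge du_j$ on $S_{|M|}$. 4. The map $\pi_{|M|}\circ\mathcal E\colon P\to\mathbb{CP}^{n-1}$ is smooth and injective, and its image is the set $U$ of points all of whose homogeneous coordinates are nonzero. The set $U$ is open and dense in $\mathbb{CP}^{n-1}$. 5. $(\pi_{|M|}\circ\mathcal E)^*(|M|\omega_{\rm FS})=\omega^{\rm loc}$. 6. $\pi_{|M|}\circ\mathcal E$ is a diffeomorphism of $P$ onto the open submanifold $U$. By 5 it is therefore a symplectic diffeomorphism of $(P,\omega^{\rm loc})$ onto $(U,|M|\omega_{\rm FS}|_U)$. -/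

import Mathlib

open scoped Manifold ContDiff LinearAlgebra.Projectivization
open TopologicalSpace

noncomputable section

namespace RSProj

/-! ### Two-forms on a real vector space -/

section Forms

variable {V : Type*} [AddCommGroup V] [Module ℝ V] [TopologicalSpace V]

/-- The wedge product `α ∧ β` of two real one-forms: `(α ∧ β)(v, w) = α v β w - α w β v`. -/
def wedge (α β : V →L[ℝ] ℝ) : V [⋀^Fin 2]→L[ℝ] ℝ :=
  ContinuousMultilinearMap.alternatization
    ((ContinuousMultilinearMap.mkPiAlgebra ℝ (Fin 2) ℝ).compContinuousLinearMap ![α, β])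

theorem wedge_apply (α β : V →L[ℝ] ℝ) (v : Fin 2 → V) :
    wedge α β v = α (v 0) * β (v 1) - α (v 1) * β (v 0) := by
  have h : (Finset.univ : Finset (Equiv.Perm (Fin 2))) = {1, Equiv.swap 0 1} := by decide
  rw [wedge, ContinuousMultilinearMap.alternatization_apply_apply, h,
    Finset.sum_pair (by decide)]
  simp [Fin.prod_univ_two, sub_eq_add_neg]

/-- For a complex-valued real-linear one-form `l` this is the real two-form `i l̄ ∧ l`,
that is `2 (Im l) ∧ (Re l)`. -/
def iConjWedge (l : V →L[ℝ] ℂ) : V [⋀^Fin 2]→L[ℝ] ℝ :=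
  (2 : ℝ) • wedge (Complex.imCLM.comp l) (Complex.reCLM.comp l)

theorem iConjWedge_apply (l : V →L[ℝ] ℂ) (v : Fin 2 → V) :
    ((iConjWedge l v : ℝ) : ℂ) = Complex.I *
      ((starRingEnd ℂ) (l (v 0)) * l (v 1) - (starRingEnd ℂ) (l (v 1)) * l (v 0)) := by
  apply Complex.ext <;> simp [iConjWedge, wedge_apply] <;> ring

end Forms

/-! ### Complex projective space as a smooth manifold -/

/-- Complex projective space of complex dimension `m`, with homogeneous coordinates indexed by
`Fin (m + 1)`. -/
abbrev CP (m : ℕ) : Type := ℙ ℂ (Fin (m + 1) → ℂ)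

variable {m : ℕ}

/-- The quotient topology on complex projective space. -/
instance instTopologicalSpaceCP : TopologicalSpace (CP m) :=
  inferInstanceAs (TopologicalSpace (Quotient (projectivizationSetoid ℂ (Fin (m + 1) → ℂ))))

theorem isQuotientMap_mk' :
    Topology.IsQuotientMap (Projectivization.mk' ℂ (V := Fin (m + 1) → ℂ)) :=
  isQuotientMap_quotient_mk'

theorem rep_mk_div (v : Fin (m + 1) → ℂ) (hv : v ≠ 0) (i j : Fin (m + 1)) :
    (Projectivization.mk ℂ v hv).rep j / (Projectivization.mk ℂ v hv).rep i = v j / v i := by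
  obtain ⟨a, ha⟩ := Projectivization.exists_smul_eq_mk_rep ℂ v hv
  rw [← ha]
  simp only [Pi.smul_apply, Units.smul_def, smul_eq_mul]
  exact mul_div_mul_left _ _ a.ne_zero

theorem rep_mk_ne_zero_iff (v : Fin (m + 1) → ℂ) (hv : v ≠ 0) (i : Fin (m + 1)) :
    (Projectivization.mk ℂ v hv).rep i ≠ 0 ↔ v i ≠ 0 := by
  obtain ⟨a, ha⟩ := Projectivization.exists_smul_eq_mk_rep ℂ v hv
  rw [← ha]
  simp [Units.smul_def]

theorem isOpen_coord_ne_zero (i : Fin (m + 1)) : IsOpen {P : CP m | P.rep i ≠ 0} := by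
  rw [← isQuotientMap_mk'.isOpen_preimage]
  have h : (Projectivization.mk' ℂ (V := Fin (m + 1) → ℂ)) ⁻¹' {P : CP m | P.rep i ≠ 0}
      = {v : {v : Fin (m + 1) → ℂ // v ≠ 0} | v.1 i ≠ 0} := by
    ext v
    exact rep_mk_ne_zero_iff v.1 v.2 i
  rw [h]
  exact isOpen_ne_fun ((continuous_apply i).comp continuous_subtype_val) continuous_const

theorem insertNth_one_ne_zero (i : Fin (m + 1)) (z : Fin m → ℂ) :
    (i.insertNth (α := fun _ => ℂ) (1 : ℂ) z : Fin (m + 1) → ℂ) ≠ 0 := fun h => by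
  have := congrFun h i
  simp at this

/-- The standard affine chart of complex projective space on the set where the `i`-th
homogeneous coordinate is nonzero: `[u] ↦ (u_j / u_i)_{j ≠ i}`. -/
def affineChart (i : Fin (m + 1)) : OpenPartialHomeomorph (CP m) (Fin m → ℂ) where
  toFun P := fun a => P.rep (i.succAbove a) / P.rep i
  invFun z := Projectivization.mk ℂ (i.insertNth (α := fun _ => ℂ) (1 : ℂ) z)
    (insertNth_one_ne_zero i z)
  source := {P | P.rep i ≠ 0}
  target := Set.univ
  map_source' _ _ := Set.mem_univ _
  map_target' z _ := (rep_mk_ne_zero_iff _ _ i).2 (by simp)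
  left_inv' P hP := by
    have hP' : P.rep i ≠ 0 := hP
    conv_rhs => rw [← Projectivization.mk_rep P]
    rw [Projectivization.mk_eq_mk_iff']
    refine ⟨(P.rep i)⁻¹, ?_⟩
    ext j
    refine Fin.succAboveCases i ?_ (fun a => ?_) j
    · simp [hP']
    · simp [div_eq_inv_mul]
  right_inv' z _ := by
    ext a
    rw [rep_mk_div]
    simp
  open_source := isOpen_coord_ne_zero i
  open_target := isOpen_univ
  continuousOn_toFun := by
    rw [isQuotientMap_mk'.continuousOn_isOpen_iff (isOpen_coord_ne_zero i)]
    refine continuousOn_pi.2 fun a => ?_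
    have h : ∀ v : {v : Fin (m + 1) → ℂ // v ≠ 0},
        (Projectivization.mk' ℂ v).rep (i.succAbove a) / (Projectivization.mk' ℂ v).rep i
          = v.1 (i.succAbove a) / v.1 i := fun v => rep_mk_div v.1 v.2 _ _
    simp only [Function.comp_def, h]
    refine ContinuousOn.div ?_ ?_ ?_
    · exact ((continuous_apply _).comp continuous_subtype_val).continuousOn
    · exact ((continuous_apply _).comp continuous_subtype_val).continuousOn
    · intro v hv
      exact (rep_mk_ne_zero_iff v.1 v.2 i).1 hv
  continuousOn_invFun := by
    refine Continuous.continuousOn ?_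
    refine (isQuotientMap_mk' (m := m)).continuous.comp (Continuous.subtype_mk ?_ _)
    refine continuous_pi fun j => ?_
    refine Fin.succAboveCases i ?_ (fun a => ?_) j
    · simpa using continuous_const
    · simpa using continuous_apply a

theorem exists_rep_ne_zero (P : CP m) : ∃ i, P.rep i ≠ 0 :=
  Function.ne_iff.1 P.rep_nonzero

/-- The atlas of affine charts. -/
instance instChartedSpaceCP : ChartedSpace (Fin m → ℂ) (CP m) where
  atlas := Set.range affineChart
  chartAt P := affineChart (exists_rep_ne_zero P).choose
  mem_chart_source P := (exists_rep_ne_zero P).choose_spec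
  chart_mem_atlas _ := Set.mem_range_self _

/-- Complex projective space is a smooth manifold of real dimension `2 m`. -/
instance instIsManifoldCP : IsManifold 𝓘(ℝ, Fin m → ℂ) ∞ (CP m) := by
  refine isManifold_of_contDiffOn _ _ _ ?_
  rintro _ _ ⟨i, rfl⟩ ⟨j, rfl⟩
  have hc : ∀ k : Fin (m + 1), ContDiff ℝ ∞
      (fun z : Fin m → ℂ => (i.insertNth (α := fun _ => ℂ) (1 : ℂ) z : Fin (m + 1) → ℂ) k) := by
    intro k
    refine Fin.succAboveCases i ?_ (fun a => ?_) k
    · simpa using contDiff_const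
    · simpa using contDiff_apply ℝ ℂ a
  refine contDiffOn_pi.2 fun a => ?_
  refine ContDiffOn.congr (f := fun z : Fin m → ℂ =>
    (i.insertNth (α := fun _ => ℂ) (1 : ℂ) z : Fin (m + 1) → ℂ) (j.succAbove a) /
    (i.insertNth (α := fun _ => ℂ) (1 : ℂ) z : Fin (m + 1) → ℂ) j) ?_ ?_
  · simp only [div_eq_mul_inv]
    refine (hc _).contDiffOn.mul ((hc j).contDiffOn.inv ?_)
    intro z hz
    have hz' : (Projectivization.mk ℂ _ (insertNth_one_ne_zero i z)).rep j ≠ 0 := by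
      simpa [affineChart] using hz
    exact (rep_mk_ne_zero_iff _ _ j).1 hz'
  · intro z _
    exact rep_mk_div _ (insertNth_one_ne_zero i z) _ _

/-- The open subset of projective space where all homogeneous coordinates are nonzero. -/
def nonzeroCoords (m : ℕ) : Opens (CP m) :=
  ⟨{P | ∀ j, P.rep j ≠ 0}, by
    rw [Set.ofPred_forall]
    exact isOpen_iInter_of_finite fun j => isOpen_coord_ne_zero j⟩

/-- The natural projection `u ↦ [u]` from the nonzero vectors to projective space (with an
irrelevant value at `u = 0`). -/
def proj (u : Fin (m + 1) → ℂ) : CP m :=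
  open Classical in
  if h : u ≠ 0 then Projectivization.mk ℂ u h
  else Projectivization.mk ℂ (fun _ => 1) (fun h => one_ne_zero (congrFun h 0))

/-- The two-form `i ∂̄∂ log (1 + |z|²)` at the point `z` of an affine chart, that is
`i Σ_a dz̄_a ∧ dz_a / (1 + |z|²) - i l̄ ∧ l / (1 + |z|²)²` with `l = Σ_a z̄_a dz_a`. -/
def fubiniStudyAffine (z : Fin m → ℂ) : (Fin m → ℂ) [⋀^Fin 2]→L[ℝ] ℝ :=
  (1 + ∑ a, ‖z a‖ ^ 2)⁻¹ • (∑ a, iConjWedge (ContinuousLinearMap.proj (R := ℝ) a))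
    - ((1 + ∑ a, ‖z a‖ ^ 2) ^ 2)⁻¹ • iConjWedge
        (∑ a, (starRingEnd ℂ) (z a) • (ContinuousLinearMap.proj a : (Fin m → ℂ) →L[ℝ] ℂ))

/-- The Fubini--Study two-form on complex projective space. The tangent space at `P` is
identified with the model space by the preferred affine chart at `P`. -/
def fubiniStudy (P : CP m) : TangentSpace 𝓘(ℝ, Fin m → ℂ) P [⋀^Fin 2]→L[ℝ] ℝ :=
  fubiniStudyAffine (chartAt (Fin m → ℂ) P P)

/-- The two-form `i Σ_j dū_j ∧ du_j` on `ℂ ^ (m + 1)`. -/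
def stdForm (m : ℕ) : (Fin (m + 1) → ℂ) [⋀^Fin 2]→L[ℝ] ℝ :=
  ∑ j, iConjWedge (ContinuousLinearMap.proj (R := ℝ) j)

/-! ### The local phase space, with `n = m + 1` particles -/

/-- The point `(ξ_1, …, ξ_n)` of the hyperplane `ξ_1 + ⋯ + ξ_n = π` with given first `n - 1`
coordinates. These coordinates identify the hyperplane with `ℝ ^ (n - 1)`. -/
def fullXi (x : Fin m → ℝ) : Fin (m + 1) → ℝ :=
  Fin.snoc (α := fun _ => ℝ) x (Real.pi - ∑ k, x k)

/-- `M = p π - n y`. -/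
def bigM (m p : ℕ) (y : ℝ) : ℝ := p * Real.pi - (m + 1) * y

/-- The sign of `M`, as an integer. -/
def sgnM (m p : ℕ) (y : ℝ) : ℤ := (SignType.sign (bigM m p y) : ℤ)

/-- `sgn(M) (ξ_j + ⋯ + ξ_{j+p-1} - y)`, with indices modulo `n`. -/
def sqAbs (p : ℕ) (y : ℝ) (x : Fin m → ℝ) (j : Fin (m + 1)) : ℝ :=
  (sgnM m p y : ℝ) * ((∑ l ∈ Finset.range p, fullXi x (Fin.ofNat (m + 1) (j + l))) - y)

/-- The closed simplex `𝒜_y` bounded by the hyperplanes `ξ_j + ⋯ + ξ_{j+p-1} = y`. -/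
def simplex (m p : ℕ) (y : ℝ) : Set (Fin m → ℝ) :=
  {x | ∀ j, 0 ≤ sqAbs p y x j}

/-- The local configuration space `𝒜_y⁺`, the interior of `𝒜_y`. -/
def configSpace (m p : ℕ) (y : ℝ) : Opens (Fin m → ℝ) :=
  ⟨interior (simplex m p y), isOpen_interior⟩

/-- The torus `𝕋^m`, as a finite product of circles, is a smooth manifold. -/
instance instIsManifoldTorus (m : ℕ) :
    IsManifold (ModelWithCorners.pi fun _ : Fin m => 𝓡 1) ∞ (Fin m → Circle) := by
  refine isManifold_of_contDiffOn _ _ _ ?_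
  rintro _ _ ⟨f, hf, rfl⟩ ⟨g, hg, rfl⟩
  have hfg : ∀ k, ContDiffOn ℝ ∞ ((𝓡 1) ∘ ((f k).symm.trans (g k)) ∘ (𝓡 1).symm)
      ((𝓡 1).symm ⁻¹' ((f k).symm.trans (g k)).source ∩ Set.range (𝓡 1)) := fun k =>
    (contDiffGroupoid ∞ (𝓡 1)).mem_iff_of_eqOnSource (Setoid.refl _) |>.1
      (HasGroupoid.compatible (G := contDiffGroupoid ∞ (𝓡 1)) (hf k trivial) (hg k trivial)) |>.1
  refine contDiffOn_pi.2 fun k => ?_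
  refine ((hfg k).comp (contDiff_apply ℝ (EuclideanSpace ℝ (Fin 1)) k).contDiffOn ?_)
  rintro w ⟨hw, -⟩
  refine ⟨?_, by simp⟩
  have h1 := hw.1
  have h2 := hw.2
  exact ⟨h1 k trivial, h2 k trivial⟩

/-- The local phase space `𝒜_y⁺ × 𝕋^(n-1)`. -/
abbrev PhaseSpace (m p : ℕ) (y : ℝ) : Type := configSpace m p y × (Fin m → Circle)

/-- The model with corners of the product manifold `𝒜_y⁺ × 𝕋^(n-1)`. -/
abbrev phaseModel (m : ℕ) :=
  (𝓘(ℝ, Fin m → ℝ)).prod (ModelWithCorners.pi fun _ : Fin m => 𝓡 1)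

/-- The one-form `dξ_k` on the local phase space. -/
def dXi {p : ℕ} {y : ℝ} (k : Fin m) (x : PhaseSpace m p y) :
    TangentSpace (phaseModel m) x →L[ℝ] ℝ :=
  mfderiv (phaseModel m) 𝓘(ℝ, ℝ) (fun x : PhaseSpace m p y => x.1.1 k) x

/-- The one-form `dθ_k` on the local phase space: with `ζ_k = e^{iθ_k}` it is
`ζ̄_k dζ_k / i`, which is the imaginary part of `ζ̄_k dζ_k`. -/
def dTheta {p : ℕ} {y : ℝ} (k : Fin m) (x : PhaseSpace m p y) :
    TangentSpace (phaseModel m) x →L[ℝ] ℝ :=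
  (Complex.imCLM.comp (ContinuousLinearMap.mul ℝ ℂ ((starRingEnd ℂ) (x.2 k : ℂ)))).comp
    (mfderiv (phaseModel m) 𝓘(ℝ, ℂ) (fun x : PhaseSpace m p y => (x.2 k : ℂ)) x)

/-- The standard symplectic form `Σ_k dθ_k ∧ dξ_k` on the local phase space. -/
def omegaLoc {p : ℕ} {y : ℝ} (x : PhaseSpace m p y) :
    TangentSpace (phaseModel m) x [⋀^Fin 2]→L[ℝ] ℝ :=
  ∑ k, wedge (dTheta k x) (dXi k x)

/-! ### The map `ℰ` -/

/-- The coefficient matrix of `ξ_1, …, ξ_{n-1}` in `ξ_j + ⋯ + ξ_{j+p-1}` for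
`j = 1, …, n - 1`, after elimination of `ξ_n` (row and column indices are shifted by one). -/
def matA (m p : ℕ) : Matrix (Fin m) (Fin m) ℤ := fun j k =>
  if (j : ℕ) + p ≤ m then (if j ≤ k ∧ (k : ℕ) < j + p then 1 else 0)
  else (if (j : ℕ) + p ≤ k + m + 1 ∧ k < j then -1 else 0)

/-- The integer matrix `Ω`, the inverse transpose of `A`. -/
def matOmega (m p : ℕ) : Matrix (Fin m) (Fin m) ℤ := ((matA m p)⁻¹).transpose

/-- The phases `u_j / |u_j|`, namely `exp (i sgn(M) Σ_k Ω_{j,k} θ_k)` for `j < n` and `1` for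
`j = n`. -/
def phase (p : ℕ) (y : ℝ) (ζ : Fin m → Circle) : Fin (m + 1) → Circle :=
  Fin.snoc (α := fun _ => Circle) (fun j => ∏ k, ζ k ^ (sgnM m p y * matOmega m p j k)) 1

/-- The map `ℰ : 𝒜_y⁺ × 𝕋^(n-1) → ℂ^n`. -/
def mapE (m p : ℕ) (y : ℝ) (x : PhaseSpace m p y) : Fin (m + 1) → ℂ := fun j =>
  (Real.sqrt (sqAbs p y x.1.1 j) : ℂ) * (phase p y x.2 j : ℂ)

/-- The composite of `ℰ` with the projection to projective space. -/
def projE (m p : ℕ) (y : ℝ) (x : PhaseSpace m p y) : CP m := proj (mapE m p y x)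

end RSProj

end

/-! Put n = m + 1 and let s_j denote `sqAbs p y x j`. The s_j are affine in ξ and add up to |M|, so
u_j = √s_j · e^{iφ_j} lies on the sphere of squared radius |M|. In polar form i dū_j ∧ du_j = dφ_j ∧
ds_j. The linear part of (s_1, …, s_{n-1}) is sgn(M) A, and the angles are φ = sgn(M) Ω θ with Ω the
inverse transpose of A and φ_n = 0. The two are dual, so Σ dφ_j ∧ ds_j = Σ dθ_k ∧ dξ_k
(`sum_phaseExp_mul_sqAbsLin`). On the sphere |M| ω_FS pulls back to i Σ dū_j ∧ du_j
(`fubiniStudy_pullback_sphere`), and composing gives the symplectic property.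

The arithmetic input is pq = nr + 1: q consecutive windows of length p go r times around the cycle
and meet one entry once more (`sum_blocks_eq_add`). Hence every entry is an integer combination of
window sums, A is unimodular (`isUnit_det_matA`), and monomial maps with exponents Ω and A are
mutually inverse on the torus. The same count, with the bounds on y, yields ξ_k > 0 (`fullXi_pos`).

For the inverse, a point with nonzero homogeneous coordinates has a unique representative on the
sphere with positive last coordinate. Its squared moduli are the s_j and determine ξ; its phases
determine e^{iθ}. Both recipes are smooth (`projEInv`). -/

namespace RSProj

/-! ### Smooth maps into and out of finite products of manifolds -/

section PiManifold

variable {𝕜 : Type*} [NontriviallyNormedField 𝕜] {ι : Type*} [Fintype ι]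
  {E : Type*} [NormedAddCommGroup E] [NormedSpace 𝕜 E]
  {H : Type*} [TopologicalSpace H] {I : ModelWithCorners 𝕜 E H}
  {M : Type*} [TopologicalSpace M] [ChartedSpace H M]
  {F : Type*} [NormedAddCommGroup F] [NormedSpace 𝕜 F]
  {G : Type*} [TopologicalSpace G] {J : ModelWithCorners 𝕜 F G}
  {N : Type*} [TopologicalSpace N] [ChartedSpace G N] {n : ℕ∞ω}

/-- Charts of a finite product act componentwise by definition; in them the coordinate projections
become linear. -/
theorem extChartAt_pi_apply (f g : ι → M) (k : ι) :
    extChartAt (ModelWithCorners.pi fun _ : ι => I) f g k = extChartAt I (f k) (g k) := rfl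

theorem contMDiff_pi_apply (k : ι) :
    ContMDiff (ModelWithCorners.pi fun _ : ι => I) I n (fun f : ι → M => f k) := by
  intro f
  rw [contMDiffAt_iff]
  refine ⟨(continuous_apply k).continuousAt, ?_⟩
  have h : ContDiffWithinAt 𝕜 n (fun w : ι → E => w k)
      (Set.range (ModelWithCorners.pi fun _ : ι => I))
      (extChartAt (ModelWithCorners.pi fun _ : ι => I) f f) :=
    (contDiff_apply 𝕜 E k).contDiffWithinAt
  refine h.congr_of_eventuallyEq ?_ ?_
  · filter_upwards [extChartAt_target_mem_nhdsWithin (I := ModelWithCorners.pi fun _ : ι => I) f]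
      with w hw
    have hs := (extChartAt (ModelWithCorners.pi fun _ : ι => I) f).right_inv hw
    have := congrFun hs k
    rw [extChartAt_pi_apply] at this
    exact this
  · simp only [Function.comp_apply, extChartAt_to_inv]
    rfl

theorem contMDiff_pi_of_apply {f : N → ι → M} (hf : ∀ k, ContMDiff J I n (fun x => f x k)) :
    ContMDiff J (ModelWithCorners.pi fun _ : ι => I) n f := by
  intro x
  rw [contMDiffAt_iff_target]
  refine ⟨continuousAt_pi.2 fun k => (hf k x).continuousAt, ?_⟩
  refine contMDiffAt_pi_space.2 fun k => ?_
  exact (contMDiffAt_iff_target.1 (hf k x)).2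

end PiManifold

/-! ### The projection to projective space and the pull-back of the Fubini–Study form -/

section ProjectiveSpace

variable {m : ℕ}

theorem proj_of_ne_zero {u : Fin (m + 1) → ℂ} (hu : u ≠ 0) :
    proj u = Projectivization.mk ℂ u hu := by
  simp [proj, hu]

theorem proj_rep_div {u : Fin (m + 1) → ℂ} (hu : u ≠ 0) (i j : Fin (m + 1)) :
    (proj u).rep j / (proj u).rep i = u j / u i := by
  rw [proj_of_ne_zero hu]
  exact rep_mk_div u hu i j

theorem proj_rep_ne_zero_iff {u : Fin (m + 1) → ℂ} (hu : u ≠ 0) (i : Fin (m + 1)) :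
    (proj u).rep i ≠ 0 ↔ u i ≠ 0 := by
  rw [proj_of_ne_zero hu]
  exact rep_mk_ne_zero_iff u hu i

theorem proj_rep (P : CP m) : proj P.rep = P := by
  rw [proj_of_ne_zero P.rep_nonzero, Projectivization.mk_rep]

theorem proj_smul {u : Fin (m + 1) → ℂ} {c : ℂ} (hc : c ≠ 0) (hu : u ≠ 0) :
    proj (c • u) = proj u := by
  rw [proj_of_ne_zero hu, proj_of_ne_zero (smul_ne_zero hc hu), Projectivization.mk_eq_mk_iff']
  exact ⟨c, rfl⟩

theorem continuousAt_proj {u : Fin (m + 1) → ℂ} (hu : u ≠ 0) : ContinuousAt proj u := by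
  have h : ContinuousOn (proj (m := m)) {u | u ≠ 0} := by
    rw [continuousOn_iff_continuous_domRestrict]
    have : Set.domRestrict {u : Fin (m + 1) → ℂ | u ≠ 0} proj
        = Projectivization.mk' ℂ (V := Fin (m + 1) → ℂ) := by
      ext1 v
      exact proj_of_ne_zero v.2
    rw [this]
    exact isQuotientMap_mk'.continuous
  exact h.continuousAt (isOpen_ne.mem_nhds hu)

/-- Adding one small c ≠ 0 to all coordinates of a representative turns its zeros into c and leaves
the other coordinates nonzero. -/
theorem dense_nonzeroCoords : Dense (nonzeroCoords m : Set (CP m)) := by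
  intro P
  have hlim : Filter.Tendsto (fun c : ℂ => proj (P.rep + fun _ => c)) (nhdsWithin 0 {0}ᶜ)
      (nhds P) := by
    have h1 : Filter.Tendsto (fun c : ℂ => P.rep + fun _ => c) (nhdsWithin 0 {0}ᶜ)
        (nhds P.rep) := by
      have : Continuous fun c : ℂ => P.rep + fun _ => c := by fun_prop
      have h := this.tendsto 0
      simp only [show (fun _ : Fin (m + 1) => (0 : ℂ)) = 0 from rfl, add_zero] at h
      exact h.mono_left nhdsWithin_le_nhds
    have h2 := continuousAt_proj P.rep_nonzero
    rw [ContinuousAt, proj_rep] at h2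
    exact h2.comp h1
  refine mem_closure_of_tendsto hlim ?_
  have hne : ∀ j, ∀ᶠ c : ℂ in nhdsWithin 0 {0}ᶜ, P.rep j + c ≠ 0 := by
    intro j
    by_cases hj : P.rep j = 0
    · filter_upwards [self_mem_nhdsWithin] with c hc
      simpa [hj] using hc
    · have : Continuous fun c : ℂ => P.rep j + c := by fun_prop
      have h := this.continuousAt (x := 0) |>.eventually_ne (by simpa using hj)
      exact h.filter_mono nhdsWithin_le_nhds
  filter_upwards [Filter.eventually_all.2 hne] with c hc j
  have h0 : (P.rep + fun _ => c) ≠ 0 := fun h => hc 0 (congrFun h 0)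
  exact (proj_rep_ne_zero_iff h0 j).2 (hc j)

/-- The preferred chart comes from an arbitrary choice of index; this is all that later computations
need to know about it. -/
theorem exists_chartAt_eq_affineChart (P : CP m) :
    ∃ i, P.rep i ≠ 0 ∧ chartAt (Fin m → ℂ) P = affineChart i :=
  ⟨_, (exists_rep_ne_zero P).choose_spec, rfl⟩

theorem affineChart_proj {u : Fin (m + 1) → ℂ} (hu : u ≠ 0) (i : Fin (m + 1)) :
    affineChart i (proj u) = fun a => u (i.succAbove a) / u i :=
  funext fun _ => proj_rep_div hu _ _

/-- The derivative at `u` of `w ↦ (w_j / w_i)_{j ≠ i}`. -/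
noncomputable def ratioDeriv (u : Fin (m + 1) → ℂ) (i : Fin (m + 1)) :
    (Fin (m + 1) → ℂ) →L[ℝ] (Fin m → ℂ) :=
  ContinuousLinearMap.pi fun a =>
    (u i)⁻¹ • ((ContinuousLinearMap.proj (i.succAbove a) : (Fin (m + 1) → ℂ) →L[ℝ] ℂ)
      - (u (i.succAbove a) / u i) • ContinuousLinearMap.proj i)

theorem hasFDerivAt_ratio {u : Fin (m + 1) → ℂ} {i : Fin (m + 1)} (hi : u i ≠ 0) :
    HasFDerivAt (𝕜 := ℝ) (fun w : Fin (m + 1) → ℂ => fun a => w (i.succAbove a) / w i)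
      (ratioDeriv u i) u := by
  refine hasFDerivAt_pi.2 fun a => ?_
  have h1 := hasFDerivAt_apply (𝕜 := ℝ) (i.succAbove a) u
  have h2 := hasFDerivAt_apply (𝕜 := ℝ) i u
  have h3 := h1.mul ((hasFDerivAt_inv' (𝕜 := ℝ) hi).comp u h2)
  simp only [div_eq_mul_inv]
  refine h3.congr_fderiv ?_
  ext v
  simp
  field_simp
  ring

theorem eventually_ne_zero {u : Fin (m + 1) → ℂ} (hu : u ≠ 0) : ∀ᶠ w in nhds u, w ≠ 0 :=
  isOpen_ne.mem_nhds hu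

theorem contMDiffAt_proj {u : Fin (m + 1) → ℂ} (hu : u ≠ 0) :
    ContMDiffAt 𝓘(ℝ, Fin (m + 1) → ℂ) 𝓘(ℝ, Fin m → ℂ) ∞ proj u := by
  rw [contMDiffAt_iff_target]
  refine ⟨continuousAt_proj hu, ?_⟩
  obtain ⟨i, hi, hc⟩ := exists_chartAt_eq_affineChart (proj u)
  rw [proj_rep_ne_zero_iff hu] at hi
  have hs : ContDiffAt ℝ ∞ (fun w : Fin (m + 1) → ℂ => fun a => w (i.succAbove a) / w i) u := by
    refine contDiffAt_pi.2 fun a => ?_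
    simp only [div_eq_mul_inv]
    exact (contDiff_apply ℝ ℂ _).contDiffAt.mul ((contDiff_apply ℝ ℂ i).contDiffAt.inv hi)
  refine hs.contMDiffAt.congr_of_eventuallyEq ?_
  filter_upwards [eventually_ne_zero hu] with w hw
  simp [extChartAt, hc, affineChart_proj hw]

theorem hasMFDerivAt_proj {u : Fin (m + 1) → ℂ} (hu : u ≠ 0) {i : Fin (m + 1)} (hi : u i ≠ 0)
    (hc : chartAt (Fin m → ℂ) (proj u) = affineChart i) :
    HasMFDerivAt 𝓘(ℝ, Fin (m + 1) → ℂ) 𝓘(ℝ, Fin m → ℂ) proj u (ratioDeriv u i) := by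
  refine ⟨continuousAt_proj hu, ?_⟩
  refine ((hasFDerivAt_ratio hi).congr_of_eventuallyEq ?_).hasFDerivWithinAt
  have : ∀ᶠ w in nhds (extChartAt 𝓘(ℝ, Fin (m + 1) → ℂ) u u), w ≠ 0 := eventually_ne_zero hu
  filter_upwards [this] with w hw
  simp only [writtenInExtChartAt, extChartAt, hc]
  exact affineChart_proj hw i

/-- The one-form `Σ_j ū_j du_j` at `u`. -/
noncomputable def radialForm (u : Fin (m + 1) → ℂ) : (Fin (m + 1) → ℂ) →L[ℝ] ℂ :=
  ∑ j, (starRingEnd ℂ) (u j) • (ContinuousLinearMap.proj j : (Fin (m + 1) → ℂ) →L[ℝ] ℂ)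

theorem radialForm_apply (u v : Fin (m + 1) → ℂ) : radialForm u v = star u ⬝ᵥ v := by
  simp [radialForm, dotProduct]

theorem stdForm_apply (v : Fin 2 → Fin (m + 1) → ℂ) :
    ((stdForm m v : ℝ) : ℂ) = Complex.I * (star (v 0) ⬝ᵥ v 1 - star (v 1) ⬝ᵥ v 0) := by
  simp only [stdForm, ContinuousAlternatingMap.sum_apply, Complex.ofReal_sum, iConjWedge_apply,
    dotProduct, ← Finset.sum_sub_distrib, Finset.mul_sum]
  simp

theorem ofReal_sum_norm_sq (u : Fin (m + 1) → ℂ) :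
    ((∑ j, ‖u j‖ ^ 2 : ℝ) : ℂ) = star u ⬝ᵥ u := by
  simp [dotProduct, ← Complex.mul_conj', mul_comm]

theorem star_dotProduct_self_ne_zero {u : Fin (m + 1) → ℂ} (hu : u ≠ 0) : star u ⬝ᵥ u ≠ 0 := by
  obtain ⟨i, hi⟩ := Function.ne_iff.1 hu
  rw [← ofReal_sum_norm_sq, Complex.ofReal_ne_zero]
  refine (Finset.sum_pos' (fun j _ => by positivity) ⟨i, Finset.mem_univ i, ?_⟩).ne'
  have : 0 < ‖u i‖ := norm_pos_iff.2 hi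
  positivity

/-- With c = u_i, the affine point is u/c and the image of a vector x is (x - (x_i/c) u)/c, each
with the i-th entry dropped. The Hermitian form on the right is degenerate along u, so subtracting
multiples of u is harmless, and the powers of c cancel. -/
theorem hermitian_ratioDeriv {u : Fin (m + 1) → ℂ} {i : Fin (m + 1)} (hi : u i ≠ 0)
    (v w : Fin (m + 1) → ℂ) :
    let z : Fin m → ℂ := fun a => u (i.succAbove a) / u i
    (1 + star z ⬝ᵥ z)⁻¹ * (star (ratioDeriv u i v) ⬝ᵥ ratioDeriv u i w)
      - ((1 + star z ⬝ᵥ z) ^ 2)⁻¹ *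
        (star (star z ⬝ᵥ ratioDeriv u i v) * (star z ⬝ᵥ ratioDeriv u i w))
      = (star u ⬝ᵥ u)⁻¹ * (star v ⬝ᵥ w)
        - ((star u ⬝ᵥ u) ^ 2)⁻¹ * (star (star u ⬝ᵥ v) * (star u ⬝ᵥ w)) := by
  intro z
  set c : ℂ := u i with hc
  have hc' : star c ≠ 0 := star_ne_zero.2 hi
  have hN : star u ⬝ᵥ u ≠ 0 := star_dotProduct_self_ne_zero fun h => hi (by simp [hc, h])
  have key : ∀ x y : Fin (m + 1) → ℂ, star (fun a => x (i.succAbove a)) ⬝ᵥ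
      (fun a => y (i.succAbove a)) = star x ⬝ᵥ y - star (x i) * y i := by
    intro x y
    simp [dotProduct, Fin.sum_univ_succAbove _ i]
  have hz : z = fun a => (c⁻¹ • u) (i.succAbove a) := by
    ext a; simp [z, hc, div_eq_inv_mul]
  have hD : ∀ x, ratioDeriv u i x
      = fun a => (c⁻¹ • (x - (x i / c) • u)) (i.succAbove a) := by
    intro x
    ext a
    simp [ratioDeriv]
    simp only [← hc]
    field_simp
  rw [hD v, hD w, hz, key, key, key, key]
  have hs : star (star u ⬝ᵥ v) = star v ⬝ᵥ u := by
    rw [Matrix.star_dotProduct, star_star]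
  have hs' : star (star u ⬝ᵥ u) = star u ⬝ᵥ u :=
    (Matrix.star_dotProduct u u).symm
  simp only [star_smul, star_sub, smul_dotProduct, dotProduct_smul, sub_dotProduct,
    dotProduct_sub, smul_eq_mul, Pi.smul_apply, Pi.sub_apply, ← hc, hs, hs', star_mul', star_inv₀,
    star_div₀, star_star]
  -- The dropped entry of u/c is 1, which restores the summand 1 in 1 + |z|² = |u|²/|c|².
  have hZ : 1 + (c⁻¹ * ((star c)⁻¹ * star u ⬝ᵥ u) - (star c)⁻¹ * star c * (c⁻¹ * c))
      = star u ⬝ᵥ u / (c * star c) := by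
    field_simp
    ring
  rw [hZ]
  field_simp
  ring

theorem iConjWedge_apply_star {V : Type*} [AddCommGroup V] [Module ℝ V] [TopologicalSpace V]
    (l : V →L[ℝ] ℂ) (v : Fin 2 → V) : ((iConjWedge l v : ℝ) : ℂ) = Complex.I *
      (star (l (v 0)) * l (v 1) - star (l (v 1)) * l (v 0)) :=
  iConjWedge_apply l v

theorem fubiniStudyAffine_apply (z : Fin m → ℂ) (v : Fin 2 → Fin m → ℂ) :
    ((fubiniStudyAffine z v : ℝ) : ℂ) = Complex.I *
      (((1 + star z ⬝ᵥ z)⁻¹ * (star (v 0) ⬝ᵥ v 1)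
        - ((1 + star z ⬝ᵥ z) ^ 2)⁻¹ * (star (star z ⬝ᵥ v 0) * (star z ⬝ᵥ v 1)))
      - ((1 + star z ⬝ᵥ z)⁻¹ * (star (v 1) ⬝ᵥ v 0)
        - ((1 + star z ⬝ᵥ z) ^ 2)⁻¹ * (star (star z ⬝ᵥ v 1) * (star z ⬝ᵥ v 0)))) := by
  have hz : ((∑ a, ‖z a‖ ^ 2 : ℝ) : ℂ) = star z ⬝ᵥ z := by
    simp [dotProduct, ← Complex.mul_conj', mul_comm]
  have hs : (∑ a, (iConjWedge (ContinuousLinearMap.proj (R := ℝ) (φ := fun _ : Fin m => ℂ) a) v : ℂ))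
      = Complex.I * (star (v 0) ⬝ᵥ v 1 - star (v 1) ⬝ᵥ v 0) := by
    simp only [iConjWedge_apply, dotProduct, ← Finset.sum_sub_distrib, Finset.mul_sum]
    simp
  have hl : ∀ x : Fin m → ℂ, (∑ a, (starRingEnd ℂ) (z a) •
      (ContinuousLinearMap.proj a : (Fin m → ℂ) →L[ℝ] ℂ)) x = star z ⬝ᵥ x := by
    intro x
    simp [dotProduct]
  simp only [fubiniStudyAffine, ContinuousAlternatingMap.sub_apply,
    ContinuousAlternatingMap.smul_apply, ContinuousAlternatingMap.sum_apply, smul_eq_mul,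
    Complex.ofReal_sub, Complex.ofReal_mul, Complex.ofReal_inv, Complex.ofReal_pow,
    Complex.ofReal_add, Complex.ofReal_one, hz, iConjWedge_apply_star, hl]
  rw [Complex.ofReal_sum, hs]
  ring

/-- Each side is i times the antisymmetrization of a Hermitian form, so `hermitian_ratioDeriv` is
used once for each order of the two vectors. -/
theorem fubiniStudy_pullback {u : Fin (m + 1) → ℂ} (hu : u ≠ 0) (v : Fin 2 → Fin (m + 1) → ℂ) :
    fubiniStudy (proj u)
        (fun a => mfderiv 𝓘(ℝ, Fin (m + 1) → ℂ) 𝓘(ℝ, Fin m → ℂ) proj u (v a))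
      = (∑ j, ‖u j‖ ^ 2)⁻¹ * stdForm m v
        - ((∑ j, ‖u j‖ ^ 2) ^ 2)⁻¹ * iConjWedge (radialForm u) v := by
  obtain ⟨i, hi, hc⟩ := exists_chartAt_eq_affineChart (proj u)
  rw [proj_rep_ne_zero_iff hu] at hi
  rw [(hasMFDerivAt_proj hu hi hc).mfderiv, fubiniStudy, hc, affineChart_proj hu]
  suffices h : fubiniStudyAffine (fun a => u (i.succAbove a) / u i)
      (fun a => ratioDeriv u i (v a)) = (∑ j, ‖u j‖ ^ 2)⁻¹ * stdForm m v
        - ((∑ j, ‖u j‖ ^ 2) ^ 2)⁻¹ * iConjWedge (radialForm u) v from h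
  have hr := hermitian_ratioDeriv hi
  simp only at hr
  rw [← Complex.ofReal_inj, fubiniStudyAffine_apply, hr, hr]
  push_cast [ofReal_sum_norm_sq, stdForm_apply, iConjWedge_apply_star, radialForm_apply]
  have hz := ofReal_sum_norm_sq u
  push_cast at hz
  rw [hz]
  ring

/-- On a sphere `Σ_j |u_j|² = r`, the pull-back of `r` times the Fubini--Study form is the
standard form. -/
theorem fubiniStudy_pullback_sphere {u : Fin (m + 1) → ℂ} (hu : u ≠ 0) {r : ℝ}
    (hr : ∑ j, ‖u j‖ ^ 2 = r) (v : Fin 2 → Fin (m + 1) → ℂ)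
    (hv : ∀ a, ∑ j, ((starRingEnd ℂ) (u j) * v a j).re = 0) :
    r * fubiniStudy (proj u)
        (fun a => mfderiv 𝓘(ℝ, Fin (m + 1) → ℂ) 𝓘(ℝ, Fin m → ℂ) proj u (v a))
      = stdForm m v := by
  have hr0 : r ≠ 0 := by
    have := star_dotProduct_self_ne_zero hu
    rwa [← ofReal_sum_norm_sq, Complex.ofReal_ne_zero, hr] at this
  -- Tangency to the sphere makes the radial one-form purely imaginary on v, so its Im ∧ Re term
  -- drops out.
  have hL : ∀ a, (radialForm u (v a)).re = 0 := by
    intro a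
    rw [← hv a]
    simp [radialForm]
  rw [fubiniStudy_pullback hu, hr, iConjWedge]
  simp [wedge_apply, hL, hr0]

end ProjectiveSpace

/-! ### Cyclic window sums and unimodularity of the matrix A -/

section CyclicSums

variable {m : ℕ} {R : Type*} [CommRing R]

/-- The sum of `p` cyclically consecutive entries, starting at the index `j`. -/
def cyclicSum (x : Fin (m + 1) → R) (p j : ℕ) : R :=
  ∑ l ∈ Finset.range p, x (Fin.ofNat (m + 1) (j + l))

theorem ofNat_add_self (j : ℕ) : Fin.ofNat (m + 1) (j + (m + 1)) = Fin.ofNat (m + 1) j := by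
  ext; simp

theorem ofNat_val (k : Fin (m + 1)) : Fin.ofNat (m + 1) k = k := by
  ext; simp

theorem cyclicSum_succ_left (x : Fin (m + 1) → R) (p j : ℕ) :
    cyclicSum x (p + 1) j = x (Fin.ofNat (m + 1) j) + cyclicSum x p (j + 1) := by
  rw [cyclicSum, Finset.sum_range_succ', add_comm, cyclicSum]
  simp only [add_zero, add_assoc, add_comm 1]

theorem cyclicSum_succ_right (x : Fin (m + 1) → R) (p j : ℕ) :
    cyclicSum x (p + 1) j = cyclicSum x p j + x (Fin.ofNat (m + 1) (j + p)) := by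
  rw [cyclicSum, Finset.sum_range_succ, cyclicSum]

theorem cyclicSum_add (x : Fin (m + 1) → R) (p q j : ℕ) :
    cyclicSum x (p + q) j = cyclicSum x p j + cyclicSum x q (j + p) := by
  simp only [cyclicSum, Finset.sum_range_add, add_assoc]

theorem cyclicSum_add_period (x : Fin (m + 1) → R) (p j : ℕ) :
    cyclicSum x p (j + (m + 1)) = cyclicSum x p j := by
  refine Finset.sum_congr rfl fun l _ => ?_
  rw [add_right_comm, ofNat_add_self]

theorem cyclicSum_ofNat (x : Fin (m + 1) → R) (p j : ℕ) :
    cyclicSum x p (Fin.ofNat (m + 1) j) = cyclicSum x p j := by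
  refine Finset.sum_congr rfl fun l _ => ?_
  congr 1
  ext; simp

/-- Shifting a full window by one step loses and regains the same entry. -/
theorem cyclicSum_full (x : Fin (m + 1) → R) (j : ℕ) : cyclicSum x (m + 1) j = ∑ i, x i := by
  induction j with
  | zero =>
    rw [cyclicSum, ← Fin.sum_univ_eq_sum_range (fun l => x (Fin.ofNat (m + 1) (0 + l)))]
    simp only [zero_add, ofNat_val]
  | succ j ih =>
    have h1 := cyclicSum_succ_left x (m + 1) j
    rw [cyclicSum_succ_right, ofNat_add_self, ih, add_comm] at h1
    exact (add_left_cancel h1).symm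

theorem cyclicSum_period_mul (x : Fin (m + 1) → R) (r j : ℕ) :
    cyclicSum x ((m + 1) * r) j = r * ∑ i, x i := by
  induction r with
  | zero => simp [cyclicSum]
  | succ r ih =>
    rw [mul_add, mul_one, cyclicSum_add, ih, cyclicSum_full]
    push_cast
    ring

theorem sum_cyclicSum_blocks (x : Fin (m + 1) → R) (p q j : ℕ) :
    ∑ t ∈ Finset.range q, cyclicSum x p (j + t * p) = cyclicSum x (p * q) j := by
  induction q with
  | zero => simp [cyclicSum]
  | succ q ih =>
    rw [Finset.sum_range_succ, ih, mul_add, mul_one, cyclicSum_add, mul_comm q]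

/-- For each offset l < p, the index j + l runs once around the cycle. -/
theorem sum_cyclicSum (x : Fin (m + 1) → R) (p : ℕ) :
    ∑ j : Fin (m + 1), cyclicSum x p j = p * ∑ i, x i := by
  simp only [cyclicSum]
  rw [Finset.sum_comm]
  have h : ∀ l, ∑ j : Fin (m + 1), x (Fin.ofNat (m + 1) (j + l)) = ∑ i, x i := by
    intro l
    rw [← cyclicSum_full x l, Fin.sum_univ_eq_sum_range (fun j => x (Fin.ofNat (m + 1) (j + l)))]
    simp only [cyclicSum, add_comm]
  simp only [h, Finset.sum_const, Finset.card_range, nsmul_eq_mul]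

/-- If `p q = 1 + n r`, then `q` consecutive blocks of length `p` starting at `k` wrap around
`r` times and count the entry `k` once more. -/
theorem sum_blocks_eq_add {p q r : ℕ} (h : p * q = (m + 1) * r + 1) (x : Fin (m + 1) → R)
    (k : Fin (m + 1)) :
    ∑ t ∈ Finset.range q, cyclicSum x p (k + t * p) = r * (∑ i, x i) + x k := by
  rw [sum_cyclicSum_blocks, h, add_comm, cyclicSum_add, add_comm, cyclicSum_period_mul]
  simp [cyclicSum]

/-- Blocks starting just after k stop one entry short of r full turns, and the missing entry is k.
-/
theorem sum_blocks_eq_sub {p q r : ℕ} (h : p * q + 1 = (m + 1) * r) (x : Fin (m + 1) → R)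
    (k : Fin (m + 1)) :
    ∑ t ∈ Finset.range q, cyclicSum x p (k + 1 + t * p) = r * (∑ i, x i) - x k := by
  rw [sum_cyclicSum_blocks, ← cyclicSum_period_mul x r k, ← h, cyclicSum_succ_left, ofNat_val]
  ring

/-- The vector with given first `m` entries and prescribed sum `c` of all entries. -/
def snocSum (c : R) (x : Fin m → R) : Fin (m + 1) → R :=
  Fin.snoc (α := fun _ => R) x (c - ∑ k, x k)

theorem sum_snocSum (c : R) (x : Fin m → R) : ∑ i, snocSum c x i = c := by
  rw [Fin.sum_univ_castSucc]
  simp [snocSum]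

theorem snocSum_castSucc (c : R) (x : Fin m → R) (k : Fin m) :
    snocSum c x k.castSucc = x k := by
  simp [snocSum]

theorem cyclicSum_snocSum_of_le (c : R) (x : Fin m → R) {p j : ℕ} (h : j + p ≤ m) :
    cyclicSum (snocSum c x) p j = ∑ k : Fin m, if j ≤ k ∧ (k : ℕ) < j + p then x k else 0 := by
  have hk : ∀ k : Fin m, x k = snocSum c x (Fin.ofNat (m + 1) k) := by
    intro k
    rw [← snocSum_castSucc c x k]
    congr 1
    ext; simp
  simp only [hk]
  rw [Fin.sum_univ_eq_sum_range
    (fun k => if j ≤ k ∧ k < j + p then snocSum c x (Fin.ofNat (m + 1) k) else 0),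
    ← Finset.sum_filter]
  have hf : (Finset.range m).filter (fun k => j ≤ k ∧ k < j + p) = Finset.Ico j (j + p) := by
    ext k; simp; omega
  rw [hf, Finset.sum_Ico_eq_sum_range]
  simp [cyclicSum]

/-- The matrix `A` gives the linear part of the sums `ξ_j + ⋯ + ξ_{j+p-1}`. -/
theorem cyclicSum_snocSum {p : ℕ} (hp : p ≤ m) (c : R) (x : Fin m → R) (j : Fin m) :
    cyclicSum (snocSum c x) p j
      = ∑ k, ((matA m p j k : ℤ) : R) * x k + if (j : ℕ) + p ≤ m then 0 else c := by
  by_cases h : (j : ℕ) + p ≤ m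
  · rw [cyclicSum_snocSum_of_le c x h]
    simp [matA, h]
  · obtain ⟨d, hd⟩ : ∃ d, (j : ℕ) + p = d + (m + 1) := ⟨j + p - (m + 1), by omega⟩
    -- The window wraps past the last index. Its complement runs from d = j + p - n to j - 1 and
    -- avoids that index, so the sum is c minus the complement; hence the entries -1.
    have h1 := cyclicSum_add (snocSum c x) p (m + 1 - p) j
    rw [show p + (m + 1 - p) = m + 1 by omega, cyclicSum_full, sum_snocSum, hd,
      cyclicSum_add_period, cyclicSum_snocSum_of_le c x (show d + (m + 1 - p) ≤ m by omega)] at h1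
    rw [eq_sub_of_add_eq h1.symm, sub_eq_add_neg, add_comm, ← Finset.sum_neg_distrib]
    simp only [h, if_false]
    congr 1
    refine Finset.sum_congr rfl fun k _ => ?_
    have hiff : (d ≤ (k : ℕ) ∧ (k : ℕ) < d + (m + 1 - p)) ↔
        ((j : ℕ) + p ≤ k + m + 1 ∧ k < j) := by
      rw [Fin.lt_def]
      omega
    simp only [matA, h, if_false, hiff]
    split_ifs <;> simp

/-- The matrix `A` is unimodular. -/
theorem isUnit_det_matA {p q : ℕ} (hp : p ≤ m) {r : ℕ} (h : p * q = (m + 1) * r + 1) :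
    IsUnit (matA m p).det := by
  -- An integral left inverse of A: extend the window sums to total zero, then add those starting at
  -- k, k + p, …, k + (q - 1)p. The r full turns contribute nothing, which leaves the entry k.
  let b : (Fin m → ℤ) →ₗ[ℤ] (Fin m → ℤ) :=
    { toFun := fun w k => ∑ t ∈ Finset.range q, snocSum 0 w (Fin.ofNat (m + 1) (k + t * p))
      map_add' := fun v w => by
        ext k
        simp only [Pi.add_apply, ← Finset.sum_add_distrib]
        refine Finset.sum_congr rfl fun t _ => ?_
        generalize Fin.ofNat (m + 1) (k + t * p) = i
        refine Fin.lastCases ?_ (fun i => ?_) i <;> simp [snocSum, Finset.sum_add_distrib]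
        ring
      map_smul' := fun c w => by
        ext k
        simp only [Pi.smul_apply, Finset.smul_sum]
        refine Finset.sum_congr rfl fun t _ => ?_
        generalize Fin.ofNat (m + 1) (k + t * p) = i
        refine Fin.lastCases ?_ (fun i => ?_) i <;> simp [snocSum, Finset.mul_sum] }
  have hb : b ∘ₗ Matrix.toLin' (matA m p) = LinearMap.id := by
    refine LinearMap.ext fun x => funext fun k => ?_
    -- All n window sums of a vector of total zero add up to zero, so the zero-sum extension
    -- supplies the correct n-th one.
    have hA : ∀ i : Fin (m + 1), snocSum 0 ((matA m p).mulVec x) i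
        = cyclicSum (snocSum 0 x) p i := by
      have hc : ∀ j : Fin m, (matA m p).mulVec x j = cyclicSum (snocSum 0 x) p j := by
        intro j
        rw [cyclicSum_snocSum hp]
        simp [Matrix.mulVec, dotProduct]
      have hs := sum_cyclicSum (snocSum 0 x) p
      rw [sum_snocSum, Fin.sum_univ_castSucc] at hs
      refine Fin.lastCases ?_ (fun i => ?_)
      · simp only [snocSum, Fin.snoc_last, hc]
        simp only [Fin.val_castSucc] at hs
        rw [zero_sub, neg_eq_iff_add_eq_zero]
        simpa [snocSum] using hs
      · rw [snocSum_castSucc, hc]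
        rfl
    have := sum_blocks_eq_add h (snocSum 0 x) k.castSucc
    rw [sum_snocSum, snocSum_castSucc] at this
    simp only [LinearMap.comp_apply, Matrix.toLin'_apply, LinearMap.id_apply]
    change ∑ t ∈ Finset.range q, snocSum 0 _ (Fin.ofNat (m + 1) (k + t * p)) = x k
    simp only [hA, cyclicSum_ofNat]
    simpa using this
  refine Matrix.isUnit_det_of_left_inverse (B := LinearMap.toMatrix' b) ?_
  have := congrArg LinearMap.toMatrix' hb
  rwa [LinearMap.toMatrix'_comp, LinearMap.toMatrix'_toLin', LinearMap.toMatrix'_id] at this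

end CyclicSums

/-! ### The simplex: positivity, affine inversion and interior -/

section Simplex

variable {m p : ℕ} {y : ℝ}

theorem fullXi_eq_snocSum (x : Fin m → ℝ) : fullXi x = snocSum Real.pi x := rfl

theorem sqAbs_eq (x : Fin m → ℝ) (j : Fin (m + 1)) :
    sqAbs p y x j = sgnM m p y * (cyclicSum (snocSum Real.pi x) p j - y) := rfl

theorem sgnM_mul_bigM : (sgnM m p y : ℝ) * bigM m p y = |bigM m p y| := by
  have : (sgnM m p y : ℝ) = (SignType.sign (bigM m p y) : ℝ) := by
    rw [sgnM]
    rcases SignType.sign (bigM m p y) with _ | _ | _ <;> simp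
  rw [this, sign_mul_self]

theorem sgnM_of_pos (h : 0 < bigM m p y) : sgnM m p y = 1 := by
  simp [sgnM, sign_pos h]

theorem sgnM_of_neg (h : bigM m p y < 0) : sgnM m p y = -1 := by
  simp [sgnM, sign_neg h]

theorem sgnM_mul_self (h : bigM m p y ≠ 0) : sgnM m p y * sgnM m p y = 1 := by
  rcases h.lt_or_gt with h | h
  · simp [sgnM_of_neg h]
  · simp [sgnM_of_pos h]

theorem sum_sqAbs (x : Fin m → ℝ) : ∑ j, sqAbs p y x j = |bigM m p y| := by
  simp only [sqAbs_eq, ← Finset.mul_sum, Finset.sum_sub_distrib, sum_cyclicSum, sum_snocSum]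
  rw [← sgnM_mul_bigM, bigM]
  simp

/-- If M > 0, then rπ + ξ_k is a sum of q windows, hence at least qy, and the lower bound on y says
exactly qy > rπ. If M < 0, put d = p - r and e = n - q, so that pe + 1 = nd. Then dπ - ξ_k is a sum
of e windows, hence at most ey, and the upper bound on y says ey < dπ. -/
theorem fullXi_pos {q r : ℕ} (h : p * q = (m + 1) * r + 1) (hp : p ≤ m) (hq : q ≤ m) (hq0 : 1 ≤ q)
    (hy : (((p : ℝ) / (m + 1) - 1 / ((m + 1) * q)) * Real.pi < y ∧
            y < p * Real.pi / (m + 1)) ∨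
          (p * Real.pi / (m + 1) < y ∧
            y < ((p : ℝ) / (m + 1) + 1 / (((m : ℝ) + 1 - q) * (m + 1))) * Real.pi))
    {x : Fin m → ℝ} (hx : x ∈ simplex m p y) (k : Fin (m + 1)) : 0 < fullXi x k := by
  have hn : (0 : ℝ) < m + 1 := by positivity
  have hq1 : (0 : ℝ) < q := by exact_mod_cast hq0
  have hR : (p : ℝ) * q = (m + 1) * r + 1 := by exact_mod_cast h
  have hx' : ∀ j : ℕ, 0 ≤ (sgnM m p y : ℝ) * (cyclicSum (snocSum Real.pi x) p j - y) := by
    intro j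
    have := hx (Fin.ofNat (m + 1) j)
    rwa [sqAbs_eq, cyclicSum_ofNat] at this
  rw [fullXi_eq_snocSum]
  rcases hy with ⟨h1, h2⟩ | ⟨h1, h2⟩
  · have hM : 0 < bigM m p y := by
      rw [lt_div_iff₀ hn] at h2
      rw [bigM]
      linarith
    simp only [sgnM_of_pos hM, Int.cast_one, one_mul, sub_nonneg] at hx'
    have hs := sum_blocks_eq_add h (snocSum Real.pi x) k
    rw [sum_snocSum] at hs
    have hle : (q : ℝ) * y ≤
        ∑ t ∈ Finset.range q, cyclicSum (snocSum Real.pi x) p (k + t * p) := by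
      have := Finset.card_nsmul_le_sum (Finset.range q)
        (fun t => cyclicSum (snocSum Real.pi x) p (k + t * p)) y fun t _ => hx' _
      simpa using this
    have h3 : (p : ℝ) / (m + 1) - 1 / ((m + 1) * q) = r / q := by
      field_simp
      linarith
    rw [h3, div_mul_eq_mul_div, div_lt_iff₀ hq1] at h1
    linarith
  · have hM : bigM m p y < 0 := by
      rw [div_lt_iff₀ hn] at h1
      rw [bigM]
      linarith
    simp only [sgnM_of_neg hM, Int.cast_neg, Int.cast_one, neg_mul, one_mul,
      neg_nonneg, sub_nonpos] at hx'
    -- Since nr < pq ≤ pn, the difference d = p - r is a natural number.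
    have hrp : r ≤ p := by
      by_contra! hlt
      have h4 : p * q ≤ p * (m + 1) := Nat.mul_le_mul_left p (by omega)
      have h5 : (m + 1) * p ≤ (m + 1) * r := Nat.mul_le_mul_left _ hlt.le
      have h6 : p * (m + 1) = (m + 1) * p := mul_comm _ _
      omega
    obtain ⟨d, rfl⟩ := Nat.exists_eq_add_of_le hrp
    obtain ⟨e, he⟩ := Nat.exists_eq_add_of_le (show q ≤ m + 1 by omega)
    have hcomp : (r + d) * e + 1 = (m + 1) * d := by
      have h7 : (r + d) * (m + 1) = (r + d) * q + (r + d) * e := by rw [he]; ring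
      have h8 : (r + d) * (m + 1) = (m + 1) * r + (m + 1) * d := by ring
      omega
    have hs := sum_blocks_eq_sub hcomp (snocSum Real.pi x) k
    rw [sum_snocSum] at hs
    have hle : ∑ t ∈ Finset.range e, cyclicSum (snocSum Real.pi x) (r + d) (k + 1 + t * (r + d))
        ≤ (e : ℝ) * y := by
      have := Finset.sum_le_card_nsmul (Finset.range e)
        (fun t => cyclicSum (snocSum Real.pi x) (r + d) (k + 1 + t * (r + d))) y fun t _ => hx' _
      simpa using this
    have heR : (m : ℝ) + 1 = q + e := by exact_mod_cast he
    have he0 : (0 : ℝ) < e := by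
      have : 0 < e := by omega
      exact_mod_cast this
    have hcR : ((r : ℝ) + d) * e + 1 = (m + 1) * d := by exact_mod_cast hcomp
    have h3 : ((r + d : ℕ) : ℝ) / (m + 1) + 1 / (((m : ℝ) + 1 - q) * (m + 1)) = d / e := by
      rw [show (m : ℝ) + 1 - q = e by linarith]
      push_cast
      field_simp
      linarith
    rw [h3, div_mul_eq_mul_div, lt_div_iff₀ he0] at h2
    linarith

theorem bigM_ne_zero {a b : ℝ}
    (hy : (a < y ∧ y < p * Real.pi / (m + 1)) ∨ (p * Real.pi / (m + 1) < y ∧ y < b)) :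
    bigM m p y ≠ 0 := by
  have hn : (0 : ℝ) < m + 1 := by positivity
  rw [bigM]
  rcases hy with ⟨-, h⟩ | ⟨h, -⟩
  · rw [lt_div_iff₀ hn] at h
    exact (by linarith : (0 : ℝ) < _).ne'
  · rw [div_lt_iff₀ hn] at h
    exact (by linarith : _ < (0 : ℝ)).ne

/-- The point of the hyperplane at which the functions `sqAbs` take prescribed values. -/
noncomputable def solveXi (m p : ℕ) (y : ℝ) (ρ : Fin (m + 1) → ℝ) : Fin m → ℝ :=
  ((matA m p)⁻¹.map (Int.cast : ℤ → ℝ)).mulVec fun j =>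
    sgnM m p y * ρ j.castSucc + y - if (j : ℕ) + p ≤ m then 0 else Real.pi

theorem map_inv_mul_map (h : IsUnit (matA m p).det) :
    (matA m p)⁻¹.map (Int.cast : ℤ → ℝ) * (matA m p).map (Int.cast : ℤ → ℝ) = 1 := by
  have h1 := congrArg (fun B : Matrix (Fin m) (Fin m) ℤ => B.map (Int.castRingHom ℝ))
    (Matrix.nonsing_inv_mul _ h)
  simp only [Matrix.map_mul] at h1
  exact h1.trans (by simp)

theorem map_mul_map_inv (h : IsUnit (matA m p).det) :
    (matA m p).map (Int.cast : ℤ → ℝ) * (matA m p)⁻¹.map (Int.cast : ℤ → ℝ) = 1 :=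
  mul_eq_one_comm.1 (map_inv_mul_map h)

theorem sqAbs_castSucc (hp : p ≤ m) (x : Fin m → ℝ) (j : Fin m) :
    sqAbs p y x j.castSucc = sgnM m p y *
      (((matA m p).map (Int.cast : ℤ → ℝ)).mulVec x j
        + (if (j : ℕ) + p ≤ m then 0 else Real.pi) - y) := by
  rw [sqAbs_eq, Fin.val_castSucc, cyclicSum_snocSum hp]
  rfl

theorem solveXi_sqAbs (h : IsUnit (matA m p).det) (hp : p ≤ m) (hM : bigM m p y ≠ 0)
    (x : Fin m → ℝ) : solveXi m p y (sqAbs p y x) = x := by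
  have hs : (sgnM m p y : ℝ) * sgnM m p y = 1 := by exact_mod_cast sgnM_mul_self hM
  have : (fun j : Fin m => (sgnM m p y : ℝ) * sqAbs p y x j.castSucc + y
      - if (j : ℕ) + p ≤ m then 0 else Real.pi)
      = ((matA m p).map (Int.cast : ℤ → ℝ)).mulVec x := by
    ext j
    rw [sqAbs_castSucc hp, ← mul_assoc, hs]
    ring
  rw [solveXi, this, Matrix.mulVec_mulVec, map_inv_mul_map h, Matrix.one_mulVec]

/-- Inverting A handles the first n - 1 values; the last agrees because both families have total
|M|. -/
theorem sqAbs_solveXi (h : IsUnit (matA m p).det) (hp : p ≤ m) (hM : bigM m p y ≠ 0)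
    {ρ : Fin (m + 1) → ℝ} (hρ : ∑ j, ρ j = |bigM m p y|) (j : Fin (m + 1)) :
    sqAbs p y (solveXi m p y ρ) j = ρ j := by
  have hs : (sgnM m p y : ℝ) * sgnM m p y = 1 := by exact_mod_cast sgnM_mul_self hM
  have hc : ∀ j : Fin m, sqAbs p y (solveXi m p y ρ) j.castSucc = ρ j.castSucc := by
    intro j
    rw [sqAbs_castSucc hp, solveXi, Matrix.mulVec_mulVec, map_mul_map_inv h, Matrix.one_mulVec]
    linear_combination ρ j.castSucc * hs
  refine Fin.lastCases ?_ hc j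
  have h1 := sum_sqAbs (p := p) (y := y) (solveXi m p y ρ)
  rw [← hρ, Fin.sum_univ_castSucc, Fin.sum_univ_castSucc] at h1
  simpa [hc] using h1

theorem contDiff_solveXi : ContDiff ℝ ∞ (solveXi m p y) := by
  refine contDiff_pi.2 fun k => ?_
  simp only [solveXi, Matrix.mulVec, dotProduct]
  fun_prop

theorem contDiff_snocSum (c : ℝ) (i : Fin (m + 1)) :
    ContDiff ℝ ∞ fun x : Fin m → ℝ => snocSum c x i := by
  refine Fin.lastCases ?_ (fun i => ?_) i
  · simp only [snocSum, Fin.snoc_last]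
    fun_prop
  · simp only [snocSum_castSucc]
    fun_prop

theorem contDiff_sqAbs (j : Fin (m + 1)) :
    ContDiff ℝ ∞ fun x : Fin m → ℝ => sqAbs p y x j := by
  simp only [sqAbs_eq, cyclicSum]
  have := contDiff_snocSum (m := m) Real.pi
  fun_prop

theorem sqAbs_add (x v : Fin m → ℝ) (j : Fin (m + 1)) :
    sqAbs p y (x + v) j = sqAbs p y x j + sgnM m p y * cyclicSum (snocSum 0 v) p j := by
  have h : ∀ i : Fin (m + 1), snocSum Real.pi (x + v) i = snocSum Real.pi x i + snocSum 0 v i := by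
    refine Fin.lastCases ?_ (fun i => ?_)
    · simp [snocSum, Finset.sum_add_distrib]
      ring
    · simp [snocSum_castSucc]
  simp only [sqAbs_eq, cyclicSum, h, Finset.sum_add_distrib]
  ring

theorem snocSum_zero_smul (c : ℝ) (v : Fin m → ℝ) :
    snocSum 0 (c • v) = c • snocSum 0 v := by
  ext i
  refine Fin.lastCases ?_ (fun i => ?_) i <;> simp [snocSum, Finset.mul_sum]

theorem sqAbs_line (x v : Fin m → ℝ) (c : ℝ) (j : Fin (m + 1)) :
    sqAbs p y (x + c • v) j = sqAbs p y x j + c * (sqAbs p y (x + v) j - sqAbs p y x j) := by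
  rw [sqAbs_add, sqAbs_add, snocSum_zero_smul]
  simp only [cyclicSum, Pi.smul_apply, smul_eq_mul, ← Finset.mul_sum]
  ring

/-- The interior of the simplex is described by the strict inequalities. -/
theorem mem_configSpace_iff (h : IsUnit (matA m p).det) (hp : p ≤ m) (hM : bigM m p y ≠ 0)
    {x : Fin m → ℝ} : x ∈ configSpace m p y ↔ ∀ j, 0 < sqAbs p y x j := by
  constructor
  · intro hx j
    have hx' : simplex m p y ∈ nhds x := mem_interior_iff_mem_nhds.1 hx
    -- The common value of all s_j at the barycentre x₀ of the simplex.
    set b : ℝ := |bigM m p y| / (m + 1) with hb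
    have hb0 : 0 < b := by positivity
    have hsum : ∑ _j : Fin (m + 1), b = |bigM m p y| := by
      simp [hb]
      field_simp
    let x₀ := solveXi m p y fun _ => b
    have hx₀ : sqAbs p y x₀ j = b := sqAbs_solveXi h hp hM hsum j
    have hcont : Filter.Tendsto (fun c : ℝ => x + c • (x₀ - x)) (nhds 0) (nhds x) := by
      have : Continuous fun c : ℝ => x + c • (x₀ - x) := by fun_prop
      simpa using this.tendsto 0
    -- From an interior point one can move slightly away from x₀, that is with c < 0, and stay in
    -- the simplex. There s_j becomes (1 - c) s_j + c b ≥ 0 with c b < 0, which forces s_j > 0.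
    have hneg : ∃ᶠ c : ℝ in nhds 0, c < 0 :=
      (frequently_lt_nhds 0)
    obtain ⟨c, hc0, hc⟩ := (hneg.and_eventually (hcont.eventually hx')).exists
    have h1 : 0 ≤ sqAbs p y (x + c • (x₀ - x)) j := hc j
    have h2 : 0 ≤ sqAbs p y x j := interior_subset hx j
    rw [sqAbs_line, add_sub_cancel, hx₀] at h1
    nlinarith [mul_neg_of_neg_of_pos hc0 hb0]
  · intro hx
    refine mem_interior_iff_mem_nhds.2 ?_
    have hev : ∀ j, ∀ᶠ z in nhds x, 0 < sqAbs p y z j := fun j =>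
      (contDiff_sqAbs j).continuous.continuousAt.eventually (lt_mem_nhds (hx j))
    filter_upwards [Filter.eventually_all.2 hev] with z hz j using (hz j).le

end Simplex

/-! ### Monomial maps with integer exponents -/

section Monomials

variable {ι : Type*} [Fintype ι]

theorem prod_zpow_eq_zpow_sum {α : Type*} [CommGroup α] (g : α) (f : ι → ℤ) :
    ∏ j, g ^ f j = g ^ ∑ j, f j := by
  classical
  induction (Finset.univ : Finset ι) using Finset.induction_on with
  | empty => simp
  | insert a s ha ih => rw [Finset.prod_insert ha, Finset.sum_insert ha, zpow_add, ih]

/-- Composing monomial maps multiplies their exponent matrices. -/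
theorem prod_zpow_prod_zpow [DecidableEq ι] {α κ : Type*} [Fintype κ] [CommGroup α] (B : Matrix κ ι ℤ)
    (C : Matrix ι κ ℤ) (h : C * B = 1) (ζ : ι → α) (k : ι) :
    ∏ j, (∏ l, ζ l ^ B j l) ^ C k j = ζ k := by
  have h1 : ∏ j, (∏ l, ζ l ^ B j l) ^ C k j = ∏ l, ζ l ^ (C * B) k l := by
    simp only [← Finset.prod_zpow, ← zpow_mul]
    rw [Finset.prod_comm]
    refine Finset.prod_congr rfl fun l _ => ?_
    simp only [Matrix.mul_apply, prod_zpow_eq_zpow_sum, mul_comm]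
  rw [h1, h, Finset.prod_eq_single k]
  · simp
  · intro l _ hl
    simp [Matrix.one_apply_ne hl.symm]
  · simp

theorem contDiffAt_prod_zpow (a : ι → ℤ) {w : ι → ℂ} (hw : ∀ k, w k ≠ 0) :
    ContDiffAt ℝ ∞ (fun w : ι → ℂ => ∏ k, w k ^ a k) w := by
  refine contDiffAt_prod fun k _ => ?_
  have h : ContDiffAt ℝ ∞ (fun z : ℂ => z ^ a k) (w k) := by
    have : ContDiffAt ℂ ∞ (fun z : ℂ => z ^ a k) (w k) :=
      (analyticAt_id.zpow (hw k)).contDiffAt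
    exact this.restrict_scalars ℝ
  exact h.comp w (contDiff_apply ℝ ℂ k).contDiffAt

/-- The logarithmic form, monomial times Σ a_k dw_k / w_k, is the one that gives angle differentials
on the torus. -/
theorem hasFDerivAt_prod_zpow [DecidableEq ι] (a : ι → ℤ) {w : ι → ℂ} (hw : ∀ k, w k ≠ 0) :
    HasFDerivAt (𝕜 := ℝ) (fun w : ι → ℂ => ∏ k, w k ^ a k)
      ((∏ k, w k ^ a k) • ∑ k, ((a k : ℂ) * (w k)⁻¹) •
        (ContinuousLinearMap.proj k : (ι → ℂ) →L[ℝ] ℂ)) w := by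
  have h : ∀ k ∈ Finset.univ, HasFDerivAt (𝕜 := ℝ) (fun w : ι → ℂ => w k ^ a k)
      (((a k : ℂ) * w k ^ (a k - 1)) • (ContinuousLinearMap.proj k : (ι → ℂ) →L[ℝ] ℂ)) w := by
    intro k _
    have h1 := ((hasDerivAt_zpow (a k) (w k) (Or.inl (hw k))).complexToReal_fderiv).comp w
      (hasFDerivAt_apply (𝕜 := ℝ) k w)
    refine h1.congr_fderiv ?_
    ext v
    simp
  refine (HasFDerivAt.finsetProd h).congr_fderiv ?_
  ext v
  simp only [sum_apply, smul_apply, smul_eq_mul,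
    Finset.mul_sum]
  refine Finset.sum_congr rfl fun k _ => ?_
  rw [← Finset.mul_prod_erase Finset.univ _ (Finset.mem_univ k), zpow_sub_one₀ (hw k)]
  simp only [ContinuousLinearMap.proj_apply]
  ring

end Monomials

/-! ### The differential of ℰ, computed in an ambient vector space -/

section Ambient

variable {m p : ℕ} {y : ℝ}

/-- The exponents of the monomials `phase p y`, the last one being trivial. -/
noncomputable def phaseExp (m p : ℕ) (y : ℝ) : Fin (m + 1) → Fin m → ℤ :=
  Fin.snoc (α := fun _ => Fin m → ℤ) (fun j k => sgnM m p y * matOmega m p j k) 0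

theorem phase_eq (ζ : Fin m → Circle) (j : Fin (m + 1)) :
    phase p y ζ j = ∏ k, ζ k ^ phaseExp m p y j k := by
  refine Fin.lastCases ?_ (fun j => ?_) j <;> simp [phase, phaseExp]

/-- The formula for `ℰ`, on an ambient vector space. -/
noncomputable def ambientE (m p : ℕ) (y : ℝ) (a : (Fin m → ℝ) × (Fin m → ℂ)) :
    Fin (m + 1) → ℂ := fun j =>
  (Real.sqrt (sqAbs p y a.1 j) : ℂ) * ∏ k, a.2 k ^ phaseExp m p y j k

/-- The inclusion of the phase space in a vector space. -/
def ambientIncl (m p : ℕ) (y : ℝ) (x : PhaseSpace m p y) : (Fin m → ℝ) × (Fin m → ℂ) :=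
  (x.1.1, fun k => x.2 k)

theorem mapE_eq (x : PhaseSpace m p y) : mapE m p y x = ambientE m p y (ambientIncl m p y x) := by
  ext j
  simp only [mapE, ambientE, ambientIncl, phase_eq]
  congr 1
  refine (map_prod Circle.coeHom _ _).trans ?_
  simp only [map_zpow]
  rfl

theorem contMDiff_circle_coe {n : ℕ∞ω} :
    ContMDiff (𝓡 1) 𝓘(ℝ, ℂ) n (fun z : Circle => (z : ℂ)) :=
  haveI := finrank_real_complex_fact'
  contMDiff_coe_sphere

theorem contMDiff_ambientIncl :
    ContMDiff (phaseModel m) 𝓘(ℝ, (Fin m → ℝ) × (Fin m → ℂ)) ∞ (ambientIncl m p y) := by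
  refine ContMDiff.prodMk_space ?_ ?_
  · exact contMDiff_subtype_val.comp contMDiff_fst
  · refine contMDiff_pi_space.2 fun k => ?_
    exact contMDiff_circle_coe.comp ((contMDiff_pi_apply k).comp contMDiff_snd)

/-- Strict positivity keeps the square roots away from their singularity, and nonvanishing permits
negative exponents. -/
theorem contDiffAt_ambientE {a : (Fin m → ℝ) × (Fin m → ℂ)} (ha : ∀ j, 0 < sqAbs p y a.1 j)
    (hw : ∀ k, a.2 k ≠ 0) : ContDiffAt ℝ ∞ (ambientE m p y) a := by
  refine contDiffAt_pi.2 fun j => ?_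
  refine ContDiffAt.mul ?_ ?_
  · have h1 : ContDiffAt ℝ ∞ (fun a : (Fin m → ℝ) × (Fin m → ℂ) => sqAbs p y a.1 j) a :=
      ((contDiff_sqAbs j).comp contDiff_fst).contDiffAt
    exact Complex.ofRealCLM.contDiff.contDiffAt.comp a (h1.sqrt (ha j).ne')
  · exact (contDiffAt_prod_zpow _ hw).comp a contDiffAt_snd

/-- The linear part of `sqAbs`. -/
noncomputable def sqAbsLin (m p : ℕ) (y : ℝ) (j : Fin (m + 1)) : (Fin m → ℝ) →L[ℝ] ℝ :=
  LinearMap.toContinuousLinearMap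
    { toFun := fun v => sgnM m p y * cyclicSum (snocSum 0 v) p j
      map_add' := fun v w => by
        have h1 := sqAbs_add (p := p) (y := y) 0 (v + w) j
        have h2 := sqAbs_add (p := p) (y := y) (0 + v) w j
        have h3 := sqAbs_add (p := p) (y := y) 0 v j
        rw [← add_assoc] at h1
        linarith
      map_smul' := fun c v => by
        simp only [snocSum_zero_smul, cyclicSum, Pi.smul_apply, smul_eq_mul, ← Finset.mul_sum,
          RingHom.id_apply]
        ring }

theorem sqAbsLin_apply (j : Fin (m + 1)) (v : Fin m → ℝ) :
    sqAbsLin m p y j v = sgnM m p y * cyclicSum (snocSum 0 v) p j := rfl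

theorem sum_sqAbsLin (v : Fin m → ℝ) : ∑ j, sqAbsLin m p y j v = 0 := by
  simp [sqAbsLin_apply, ← Finset.mul_sum, sum_cyclicSum, sum_snocSum]

theorem hasFDerivAt_sqAbs (j : Fin (m + 1)) (x : Fin m → ℝ) :
    HasFDerivAt (fun x => sqAbs p y x j) (sqAbsLin m p y j) x := by
  have h : (fun x => sqAbs p y x j) = fun x : Fin m → ℝ => sqAbs p y 0 j + sqAbsLin m p y j x := by
    ext x
    rw [sqAbsLin_apply, ← sqAbs_add, zero_add]
  rw [h]
  exact (sqAbsLin m p y j).hasFDerivAt.const_add _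

theorem norm_ambientE_sq {a : (Fin m → ℝ) × (Fin m → ℂ)} (hw : ∀ k, ‖a.2 k‖ = 1)
    {j : Fin (m + 1)} (ha : 0 ≤ sqAbs p y a.1 j) :
    ‖ambientE m p y a j‖ ^ 2 = sqAbs p y a.1 j := by
  simp [ambientE, hw, Real.sq_sqrt ha]

/-- For u = √s ψ with |ψ| = 1 one has ū du = ds/2 + s dψ/ψ, and 1/w_k is the conjugate of w_k on the
unit circle. -/
theorem conj_ambientE_mul_fderiv {a : (Fin m → ℝ) × (Fin m → ℂ)}
    (ha : ∀ j, 0 < sqAbs p y a.1 j) (hw : ∀ k, ‖a.2 k‖ = 1)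
    (v : (Fin m → ℝ) × (Fin m → ℂ)) (j : Fin (m + 1)) :
    (starRingEnd ℂ) (ambientE m p y a j) * fderiv ℝ (ambientE m p y) a v j
      = ((sqAbsLin m p y j v.1 / 2 : ℝ) : ℂ)
        + sqAbs p y a.1 j * ∑ k, phaseExp m p y j k * ((starRingEnd ℂ) (a.2 k) * v.2 k) := by
  have hw0 : ∀ k, a.2 k ≠ 0 := fun k h => by simpa [h] using hw k
  have hd : DifferentiableAt ℝ (ambientE m p y) a :=
    (contDiffAt_ambientE ha hw0).differentiableAt (by simp)
  have hj : fderiv ℝ (ambientE m p y) a v j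
      = fderiv ℝ (fun b => ambientE m p y b j) a v := by
    have := (hasFDerivAt_pi'.1 hd.hasFDerivAt j).fderiv
    rw [this]
    rfl
  have h1 := ((hasFDerivAt_sqAbs (p := p) (y := y) j a.1).comp a hasFDerivAt_fst).sqrt (ha j).ne'
  have h2 := Complex.ofRealCLM.hasFDerivAt.comp a h1
  have h3 := (hasFDerivAt_prod_zpow (phaseExp m p y j) hw0).comp a
    (hasFDerivAt_snd (𝕜 := ℝ) (E := Fin m → ℝ) (F := Fin m → ℂ))
  have h4 : fderiv ℝ (fun b => ambientE m p y b j) a = _ := (h2.mul h3).fderiv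
  rw [hj, h4]
  have hinv : ∀ k, (a.2 k)⁻¹ = (starRingEnd ℂ) (a.2 k) := fun k => by
    rw [Complex.inv_def, Complex.normSq_eq_norm_sq, hw k]
    simp
  set ψ : ℂ := ∏ k, a.2 k ^ phaseExp m p y j k with hψ
  have hψ1 : (starRingEnd ℂ) ψ * ψ = 1 := by
    rw [mul_comm, Complex.mul_conj', hψ]
    simp [hw]
  set t : ℝ := Real.sqrt (sqAbs p y a.1 j) with ht
  have ht0 : (t : ℂ) ≠ 0 := Complex.ofReal_ne_zero.2 (Real.sqrt_pos.2 (ha j)).ne'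
  have hts : (sqAbs p y a.1 j : ℂ) = t * t := by
    rw [← Complex.ofReal_mul, ht, Real.mul_self_sqrt (ha j).le]
  rw [hts]
  have htt : (t : ℂ) * (t : ℂ)⁻¹ = 1 := mul_inv_cancel₀ ht0
  simp [ambientE, ← hψ, ← ht, hinv]
  simp only [← mul_assoc]
  linear_combination (t * t * ∑ k, phaseExp m p y j k * (starRingEnd ℂ) (a.2 k) * v.2 k
    + t * (t : ℂ)⁻¹ * sqAbsLin m p y j v.1 / 2) * hψ1 + sqAbsLin m p y j v.1 / 2 * htt

theorem sqAbs_pos (h : IsUnit (matA m p).det) (hp : p ≤ m) (hM : bigM m p y ≠ 0)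
    (x : PhaseSpace m p y) (j : Fin (m + 1)) : 0 < sqAbs p y x.1.1 j :=
  (mem_configSpace_iff h hp hM).1 x.1.2 j

theorem norm_mapE_sq (x : PhaseSpace m p y) (j : Fin (m + 1)) :
    ‖mapE m p y x j‖ ^ 2 = sqAbs p y x.1.1 j := by
  have h : x.1.1 ∈ simplex m p y := interior_subset x.1.2
  rw [mapE_eq]
  exact norm_ambientE_sq (a := ambientIncl m p y x) (fun k => Circle.norm_coe _) (h j)

theorem sum_norm_mapE_sq (x : PhaseSpace m p y) :
    ∑ j, ‖mapE m p y x j‖ ^ 2 = |bigM m p y| := by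
  simp only [norm_mapE_sq, sum_sqAbs]

theorem mapE_ne_zero (hM : bigM m p y ≠ 0) (x : PhaseSpace m p y) : mapE m p y x ≠ 0 := by
  intro h
  have := sum_norm_mapE_sq x
  rw [h] at this
  simp at this
  exact hM (abs_eq_zero.1 this.symm)

theorem contDiffAt_ambientE_incl (hpos : ∀ x : PhaseSpace m p y, ∀ j, 0 < sqAbs p y x.1.1 j)
    (x : PhaseSpace m p y) : ContDiffAt ℝ ∞ (ambientE m p y) (ambientIncl m p y x) :=
  contDiffAt_ambientE (hpos x) fun k => Circle.coe_ne_zero (x.2 k)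

theorem contMDiff_mapE (hpos : ∀ x : PhaseSpace m p y, ∀ j, 0 < sqAbs p y x.1.1 j) :
    ContMDiff (phaseModel m) 𝓘(ℝ, Fin (m + 1) → ℂ) ∞ (mapE m p y) := by
  rw [funext mapE_eq]
  intro x
  exact (contDiffAt_ambientE_incl hpos x).contMDiffAt.comp x (contMDiff_ambientIncl x)

theorem contMDiff_projE (hM : bigM m p y ≠ 0)
    (hpos : ∀ x : PhaseSpace m p y, ∀ j, 0 < sqAbs p y x.1.1 j) :
    ContMDiff (phaseModel m) 𝓘(ℝ, Fin m → ℂ) ∞ (projE m p y) := fun x =>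
  (contMDiffAt_proj (mapE_ne_zero hM x)).comp x (contMDiff_mapE hpos x)

theorem mfderiv_projE (hM : bigM m p y ≠ 0)
    (hpos : ∀ x : PhaseSpace m p y, ∀ j, 0 < sqAbs p y x.1.1 j) (x : PhaseSpace m p y) :
    mfderiv (phaseModel m) 𝓘(ℝ, Fin m → ℂ) (projE m p y) x
      = (mfderiv 𝓘(ℝ, Fin (m + 1) → ℂ) 𝓘(ℝ, Fin m → ℂ) proj (mapE m p y x)).comp
        (mfderiv (phaseModel m) 𝓘(ℝ, Fin (m + 1) → ℂ) (mapE m p y) x) :=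
  mfderiv_comp x ((contMDiffAt_proj (mapE_ne_zero hM x)).mdifferentiableAt (by simp))
    ((contMDiff_mapE hpos x).mdifferentiableAt (by simp))

theorem mdifferentiableAt_ambientIncl (x : PhaseSpace m p y) :
    MDifferentiableAt (phaseModel m) 𝓘(ℝ, (Fin m → ℝ) × (Fin m → ℂ)) (ambientIncl m p y) x :=
  (contMDiff_ambientIncl x).mdifferentiableAt (by simp)

/-- The chain rule moves the calculus of ℰ from the product manifold to an ordinary Fréchet
derivative. -/
theorem mfderiv_mapE (hpos : ∀ x : PhaseSpace m p y, ∀ j, 0 < sqAbs p y x.1.1 j)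
    (x : PhaseSpace m p y) :
    mfderiv (phaseModel m) 𝓘(ℝ, Fin (m + 1) → ℂ) (mapE m p y) x
      = (fderiv ℝ (ambientE m p y) (ambientIncl m p y x)).comp
        (mfderiv (phaseModel m) 𝓘(ℝ, (Fin m → ℝ) × (Fin m → ℂ)) (ambientIncl m p y) x) := by
  rw [funext mapE_eq]
  have h := ((contDiffAt_ambientE_incl hpos x).differentiableAt (by simp)).hasFDerivAt.hasMFDerivAt
  exact (h.comp x (mdifferentiableAt_ambientIncl x).hasMFDerivAt).mfderiv

theorem mfderiv_ambientIncl_fst (x : PhaseSpace m p y) (v : TangentSpace (phaseModel m) x)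
    (k : Fin m) :
    (mfderiv (phaseModel m) 𝓘(ℝ, (Fin m → ℝ) × (Fin m → ℂ)) (ambientIncl m p y) x v).1 k
      = dXi k x v := by
  let L : (Fin m → ℝ) × (Fin m → ℂ) →L[ℝ] ℝ :=
    (ContinuousLinearMap.proj k).comp (ContinuousLinearMap.fst ℝ _ _)
  have h := (L.hasMFDerivAt.comp x (mdifferentiableAt_ambientIncl x).hasMFDerivAt).mfderiv
  exact (DFunLike.congr_fun h v).symm

theorem mfderiv_ambientIncl_snd (x : PhaseSpace m p y) (v : TangentSpace (phaseModel m) x)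
    (k : Fin m) :
    (mfderiv (phaseModel m) 𝓘(ℝ, (Fin m → ℝ) × (Fin m → ℂ)) (ambientIncl m p y) x v).2 k
      = mfderiv (phaseModel m) 𝓘(ℝ, ℂ) (fun x : PhaseSpace m p y => (x.2 k : ℂ)) x v := by
  let L : (Fin m → ℝ) × (Fin m → ℂ) →L[ℝ] ℂ :=
    (ContinuousLinearMap.proj k).comp (ContinuousLinearMap.snd ℝ _ _)
  have h := (L.hasMFDerivAt.comp x (mdifferentiableAt_ambientIncl x).hasMFDerivAt).mfderiv
  exact (DFunLike.congr_fun h v).symm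

/-- The logarithmic derivative of a circle-valued coordinate is imaginary. -/
theorem conj_mul_mfderiv_snd (x : PhaseSpace m p y) (v : TangentSpace (phaseModel m) x)
    (k : Fin m) {D : ℂ}
    (hD : mfderiv (phaseModel m) 𝓘(ℝ, ℂ) (fun x : PhaseSpace m p y => (x.2 k : ℂ)) x v = D) :
    (starRingEnd ℂ) (x.2 k : ℂ) * D = Complex.I * (dTheta k x v : ℝ) := by
  have hf : MDifferentiableAt (phaseModel m) 𝓘(ℝ, ℂ) (fun x : PhaseSpace m p y => (x.2 k : ℂ)) x :=
    (((contMDiff_circle_coe (n := ∞)).comp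
      ((contMDiff_pi_apply k).comp contMDiff_snd)) x).mdifferentiableAt (by simp)
  -- Differentiating |ζ_k|² = 1 kills the real part of the product; the imaginary part is `dTheta`
  -- by definition.
  have hsq : HasFDerivAt (fun z : ℂ => z.re * z.re + z.im * z.im)
      ((((x.2 k : ℂ).re • Complex.reCLM + (x.2 k : ℂ).re • Complex.reCLM)
        + ((x.2 k : ℂ).im • Complex.imCLM + (x.2 k : ℂ).im • Complex.imCLM)) : ℂ →L[ℝ] ℝ)
      (x.2 k : ℂ) :=
    (Complex.reCLM.hasFDerivAt.mul Complex.reCLM.hasFDerivAt).add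
      (Complex.imCLM.hasFDerivAt.mul Complex.imCLM.hasFDerivAt)
  have h1 := (hsq.hasMFDerivAt.comp x hf.hasMFDerivAt).mfderiv
  have hconst : (fun z : ℂ => z.re * z.re + z.im * z.im) ∘
      (fun x : PhaseSpace m p y => (x.2 k : ℂ)) = fun _ => 1 := by
    ext x
    have := Circle.normSq_coe (x.2 k)
    rwa [Complex.normSq_apply] at this
  rw [hconst, mfderiv_const] at h1
  have h2 := DFunLike.congr_fun h1 v
  have h3 : (0 : ℝ) = ((x.2 k : ℂ).re * D.re + (x.2 k : ℂ).re * D.re)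
    + ((x.2 k : ℂ).im * D.im + (x.2 k : ℂ).im * D.im) := by
    rw [← hD]
    exact h2
  have h4 : dTheta k x v = ((starRingEnd ℂ) (x.2 k : ℂ) * D).im := by
    rw [← hD]
    rfl
  rw [h4]
  apply Complex.ext
  · simp
    linarith
  · simp

theorem conj_mapE_mul_mfderiv (hpos : ∀ x : PhaseSpace m p y, ∀ j, 0 < sqAbs p y x.1.1 j)
    (x : PhaseSpace m p y) (v : TangentSpace (phaseModel m) x) (j : Fin (m + 1)) :
    (starRingEnd ℂ) (mapE m p y x j) *
      (mfderiv (phaseModel m) 𝓘(ℝ, Fin (m + 1) → ℂ) (mapE m p y) x v : Fin (m + 1) → ℂ) j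
      = ((sqAbsLin m p y j (fun k => dXi k x v) / 2 : ℝ) : ℂ)
        + Complex.I * (sqAbs p y x.1.1 j * ∑ k, phaseExp m p y j k * dTheta k x v : ℝ) := by
  have h := conj_ambientE_mul_fderiv (a := ambientIncl m p y x) (hpos x)
    (fun k => Circle.norm_coe _)
    (mfderiv (phaseModel m) 𝓘(ℝ, (Fin m → ℝ) × (Fin m → ℂ)) (ambientIncl m p y) x v) j
  rw [← mapE_eq] at h
  rw [mfderiv_mapE hpos]
  refine h.trans ?_
  have h1 : (mfderiv (phaseModel m) 𝓘(ℝ, (Fin m → ℝ) × (Fin m → ℂ)) (ambientIncl m p y) x v).1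
      = fun k => dXi k x v := funext fun k => mfderiv_ambientIncl_fst x v k
  have h2 : ∀ k, (starRingEnd ℂ) ((ambientIncl m p y x).2 k) *
      (mfderiv (phaseModel m) 𝓘(ℝ, (Fin m → ℝ) × (Fin m → ℂ)) (ambientIncl m p y) x v).2 k
      = Complex.I * (dTheta k x v : ℝ) := fun k =>
    conj_mul_mfderiv_snd x v k (mfderiv_ambientIncl_snd x v k).symm
  rw [h1]
  simp only [h2]
  push_cast
  simp only [Finset.mul_sum]
  congr 1
  refine Finset.sum_congr rfl fun k _ => ?_
  simp only [ambientIncl]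
  ring

end Ambient

/-! ### The symplectic property -/

section Symplectic

variable {m p : ℕ} {y : ℝ}

/-- This is i dū ∧ du = dφ ∧ dρ in polar coordinates. Multiplying by ρ_j = |u_j|² expresses
everything through the products ū_j D_j, and positivity lets ρ_j be cancelled again. -/
theorem stdForm_of_conj_mul {u : Fin (m + 1) → ℂ} {ρ : Fin (m + 1) → ℝ}
    (hu : ∀ j, ‖u j‖ ^ 2 = ρ j) (hρ : ∀ j, 0 < ρ j) {D : Fin 2 → Fin (m + 1) → ℂ}
    {r φ : Fin 2 → Fin (m + 1) → ℝ}
    (hD : ∀ a j, (starRingEnd ℂ) (u j) * D a j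
      = ((r a j / 2 : ℝ) : ℂ) + Complex.I * (ρ j * φ a j : ℝ)) :
    stdForm m D = ∑ j, (φ 0 j * r 1 j - φ 1 j * r 0 j) := by
  rw [stdForm, ContinuousAlternatingMap.sum_apply]
  refine Finset.sum_congr rfl fun j _ => ?_
  have hre : ∀ a, (u j).re * (D a j).re + (u j).im * (D a j).im = r a j / 2 := fun a => by
    simpa using congrArg Complex.re (hD a j)
  have him : ∀ a, (u j).re * (D a j).im - (u j).im * (D a j).re = ρ j * φ a j := fun a => by
    have := congrArg Complex.im (hD a j)
    simp at this
    linarith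
  have hn : (u j).re * (u j).re + (u j).im * (u j).im = ρ j := by
    rw [← hu, ← Complex.normSq_eq_norm_sq, Complex.normSq_apply]
  have h1 : iConjWedge (ContinuousLinearMap.proj (R := ℝ) (φ := fun _ => ℂ) j) D
      = 2 * ((D 0 j).im * (D 1 j).re - (D 1 j).im * (D 0 j).re) := by
    simp [iConjWedge, wedge_apply]
  rw [h1]
  refine mul_left_cancel₀ (hρ j).ne' ?_
  have h2 : ρ j * (2 * ((D 0 j).im * (D 1 j).re - (D 1 j).im * (D 0 j).re))
      = 2 * (ρ j * φ 0 j * (r 1 j / 2) - ρ j * φ 1 j * (r 0 j / 2)) := by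
    rw [← him, ← him, ← hre, ← hre, ← hn]
    ring
  rw [h2]
  ring

/-- The linear parts of the action variables and of the angles are dual to each other. -/
theorem sum_phaseExp_mul_sqAbsLin (h : IsUnit (matA m p).det) (hp : p ≤ m)
    (hM : bigM m p y ≠ 0) (θ ξ : Fin m → ℝ) :
    ∑ j, (∑ k, phaseExp m p y j k * θ k) * sqAbsLin m p y j ξ = ∑ k, θ k * ξ k := by
  have hs : (sgnM m p y : ℝ) * sgnM m p y = 1 := by exact_mod_cast sgnM_mul_self hM
  rw [Fin.sum_univ_castSucc]
  have hlast : ∑ k, (phaseExp m p y (Fin.last m) k : ℝ) * θ k = 0 := by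
    simp [phaseExp]
  rw [hlast, zero_mul, add_zero]
  -- The two factors sgn(M) cancel, and what remains pairs θA⁻¹ with Aξ.
  have hj : ∀ j : Fin m, (∑ k, (phaseExp m p y j.castSucc k : ℝ) * θ k)
      * sqAbsLin m p y j.castSucc ξ
      = Matrix.vecMul θ ((matA m p)⁻¹.map (Int.cast : ℤ → ℝ)) j
        * ((matA m p).map (Int.cast : ℤ → ℝ)).mulVec ξ j := by
    intro j
    have h1 : ∑ k, (phaseExp m p y j.castSucc k : ℝ) * θ k
        = sgnM m p y * Matrix.vecMul θ ((matA m p)⁻¹.map (Int.cast : ℤ → ℝ)) j := by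
      simp only [Matrix.vecMul, dotProduct, Finset.mul_sum]
      refine Finset.sum_congr rfl fun k _ => ?_
      simp [phaseExp, matOmega]
      ring
    have h2 : sqAbsLin m p y j.castSucc ξ
        = sgnM m p y * ((matA m p).map (Int.cast : ℤ → ℝ)).mulVec ξ j := by
      rw [sqAbsLin_apply, Fin.val_castSucc, cyclicSum_snocSum hp]
      simp [Matrix.mulVec, dotProduct]
    rw [h1, h2]
    linear_combination (Matrix.vecMul θ ((matA m p)⁻¹.map (Int.cast : ℤ → ℝ)) j
      * ((matA m p).map (Int.cast : ℤ → ℝ)).mulVec ξ j) * hs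
  rw [Finset.sum_congr rfl fun j _ => hj j]
  change Matrix.vecMul θ _ ⬝ᵥ Matrix.mulVec _ ξ = θ ⬝ᵥ ξ
  rw [← Matrix.dotProduct_mulVec, Matrix.mulVec_mulVec, map_inv_mul_map h, Matrix.one_mulVec]

theorem fubiniStudy_pullback_projE (h : IsUnit (matA m p).det) (hp : p ≤ m)
    (hM : bigM m p y ≠ 0) (x : PhaseSpace m p y) :
    (|bigM m p y| • fubiniStudy (projE m p y x)).compContinuousLinearMap
      (mfderiv (phaseModel m) 𝓘(ℝ, Fin m → ℂ) (projE m p y) x) = omegaLoc x := by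
  have hpos := sqAbs_pos h hp hM
  ext v
  let D : Fin 2 → Fin (m + 1) → ℂ := fun a =>
    mfderiv (phaseModel m) 𝓘(ℝ, Fin (m + 1) → ℂ) (mapE m p y) x (v a)
  let r : Fin 2 → Fin (m + 1) → ℝ := fun a j => sqAbsLin m p y j fun k => dXi k x (v a)
  let φ : Fin 2 → Fin (m + 1) → ℝ := fun a j => ∑ k, phaseExp m p y j k * dTheta k x (v a)
  have hD : ∀ a j, (starRingEnd ℂ) (mapE m p y x j) * D a j
      = ((r a j / 2 : ℝ) : ℂ) + Complex.I * (sqAbs p y x.1.1 j * φ a j : ℝ) :=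
    fun a j => conj_mapE_mul_mfderiv hpos x (v a) j
  -- The image vectors are tangent to the sphere because the s_j have constant sum.
  have hv : ∀ a, ∑ j, ((starRingEnd ℂ) (mapE m p y x j) * D a j).re = 0 := by
    intro a
    have : ∀ j, ((starRingEnd ℂ) (mapE m p y x j) * D a j).re = r a j / 2 := fun j => by
      rw [hD, Complex.add_re, Complex.ofReal_re, Complex.I_mul_re, Complex.ofReal_im, neg_zero,
        add_zero]
    simp only [this, ← Finset.sum_div]
    simp only [r, sum_sqAbsLin, zero_div]
  have h1 := fubiniStudy_pullback_sphere (mapE_ne_zero hM x) (sum_norm_mapE_sq x) D hv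
  rw [mfderiv_projE hM hpos]
  refine h1.trans ?_
  rw [stdForm_of_conj_mul (norm_mapE_sq x) (hpos x) hD, Finset.sum_sub_distrib]
  have hpair : ∀ a b, ∑ j, φ a j * r b j = ∑ k, dTheta k x (v a) * dXi k x (v b) :=
    fun a b => sum_phaseExp_mul_sqAbsLin h hp hM _ _
  rw [hpair, hpair, omegaLoc, ContinuousAlternatingMap.sum_apply, ← Finset.sum_sub_distrib]
  refine Finset.sum_congr rfl fun k _ => ?_
  rw [wedge_apply]

end Symplectic

/-! ### The inverse map and the diffeomorphism -/

section Inverse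

variable {m p : ℕ} {y : ℝ}

/-- The homogeneous coordinates on `nonzeroCoords m`, normalized so that the last one is `1`. -/
noncomputable def normCoord (P : nonzeroCoords m) (j : Fin (m + 1)) : ℂ := P.1.rep j / P.1.rep (Fin.last m)

theorem normCoord_ne_zero (P : nonzeroCoords m) (j : Fin (m + 1)) : normCoord P j ≠ 0 :=
  div_ne_zero (P.2 j) (P.2 _)

theorem normCoord_last (P : nonzeroCoords m) : normCoord P (Fin.last m) = 1 :=
  div_self (P.2 _)

theorem proj_normCoord (P : nonzeroCoords m) : proj (normCoord P) = P.1 := by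
  have h : normCoord P = (P.1.rep (Fin.last m))⁻¹ • P.1.rep := by
    ext j
    simp [normCoord, div_eq_inv_mul]
  rw [h, proj_smul (inv_ne_zero (P.2 _)) P.1.rep_nonzero, proj_rep]

/-- These functions are the components of the affine chart at the last index, together with the
constant 1. -/
theorem contMDiff_normCoord (j : Fin (m + 1)) :
    ContMDiff 𝓘(ℝ, Fin m → ℂ) 𝓘(ℝ, ℂ) ∞ fun P : nonzeroCoords m => normCoord P j := by
  refine Fin.lastCases ?_ (fun j => ?_) j
  · simp only [normCoord_last]
    exact contMDiff_const
  · intro P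
    have h1 : affineChart (Fin.last m) ∈
        IsManifold.maximalAtlas 𝓘(ℝ, Fin m → ℂ) ∞ (CP m) :=
      IsManifold.subset_maximalAtlas ⟨_, rfl⟩
    have h2 := (contMDiffOn_of_mem_maximalAtlas h1).contMDiffAt
      ((affineChart (Fin.last m)).open_source.mem_nhds (P.2 (Fin.last m)))
    have h3 := h2.comp P (contMDiff_subtype_val P)
    have h4 := contMDiffAt_pi_space.1 h3 j
    refine h4.congr_of_eventuallyEq (Filter.Eventually.of_forall fun Q => ?_)
    simp [normCoord, affineChart]

/-- The normalized squared absolute values of the homogeneous coordinates. -/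
noncomputable def actionCoord (m p : ℕ) (y : ℝ) (P : nonzeroCoords m) (j : Fin (m + 1)) : ℝ :=
  |bigM m p y| * ‖normCoord P j‖ ^ 2 / ∑ i, ‖normCoord P i‖ ^ 2

theorem sum_norm_normCoord_pos (P : nonzeroCoords m) : 0 < ∑ i, ‖normCoord P i‖ ^ 2 :=
  Finset.sum_pos (fun j _ => pow_pos (norm_pos_iff.2 (normCoord_ne_zero P j)) 2)
    Finset.univ_nonempty

theorem actionCoord_pos (hM : bigM m p y ≠ 0) (P : nonzeroCoords m) (j : Fin (m + 1)) :
    0 < actionCoord m p y P j :=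
  div_pos (mul_pos (abs_pos.2 hM) (pow_pos (norm_pos_iff.2 (normCoord_ne_zero P j)) 2))
    (sum_norm_normCoord_pos P)

theorem sum_actionCoord (P : nonzeroCoords m) : ∑ j, actionCoord m p y P j = |bigM m p y| := by
  simp only [actionCoord, ← Finset.sum_div, ← Finset.mul_sum]
  exact mul_div_cancel_right₀ _ (sum_norm_normCoord_pos P).ne'

theorem contMDiff_normCoord_pi :
    ContMDiff 𝓘(ℝ, Fin m → ℂ) 𝓘(ℝ, Fin (m + 1) → ℂ) ∞
      fun P : nonzeroCoords m => normCoord P :=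
  contMDiff_pi_space.2 contMDiff_normCoord

theorem contMDiff_actionCoord :
    ContMDiff 𝓘(ℝ, Fin m → ℂ) 𝓘(ℝ, Fin (m + 1) → ℝ) ∞ (actionCoord m p y) := by
  refine contMDiff_pi_space.2 fun j P => ?_
  have h : ContDiffAt ℝ ∞ (fun z : Fin (m + 1) → ℂ =>
      |bigM m p y| * ‖z j‖ ^ 2 / ∑ i, ‖z i‖ ^ 2) (normCoord P) := by
    have hn : ∀ i, ContDiff ℝ ∞ fun z : Fin (m + 1) → ℂ => ‖z i‖ ^ 2 := fun i =>
      (contDiff_norm_sq ℝ).comp (contDiff_apply ℝ ℂ i)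
    exact (contDiffAt_const.mul (hn j).contDiffAt).div
      (ContDiff.sum fun i _ => hn i).contDiffAt (sum_norm_normCoord_pos P).ne'
  exact h.contMDiffAt.comp P (contMDiff_normCoord_pi P)

/-- The phase of a nonzero complex number. -/
noncomputable def unitPhase (z : ℂ) (hz : z ≠ 0) : Circle :=
  ⟨z / ‖z‖, mem_sphere_zero_iff_norm.2 (by simp [hz])⟩

theorem coe_unitPhase (z : ℂ) (hz : z ≠ 0) : (unitPhase z hz : ℂ) = z / ‖z‖ := rfl

theorem unitPhase_ofReal_mul {c : ℝ} (hc : 0 < c) (ζ : Circle) (h : (c : ℂ) * ζ ≠ 0) :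
    unitPhase (c * ζ) h = ζ := by
  ext
  have : (c : ℂ) ≠ 0 := Complex.ofReal_ne_zero.2 hc.ne'
  rw [coe_unitPhase, norm_mul, Circle.norm_coe, Complex.norm_real, Real.norm_eq_abs,
    abs_of_pos hc, mul_one, mul_div_cancel_left₀ _ this]

/-- Smoothness holds for z/|z| as a map to ℂ away from 0, and passes to the circle by restricting
the codomain. -/
theorem contMDiff_unitPhase {E H M : Type*} [NormedAddCommGroup E] [NormedSpace ℝ E]
    [TopologicalSpace H] {I : ModelWithCorners ℝ E H} [TopologicalSpace M] [ChartedSpace H M]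
    [IsManifold I ∞ M] {f : M → ℂ} (hf : ContMDiff I 𝓘(ℝ, ℂ) ∞ f) (h0 : ∀ x, f x ≠ 0) :
    ContMDiff I (𝓡 1) ∞ fun x => unitPhase (f x) (h0 x) := by
  have := finrank_real_complex_fact'
  have h1 : ContMDiff I 𝓘(ℝ, ℂ) ∞ fun x => f x / (‖f x‖ : ℂ) := by
    intro x
    have h2 : ContDiffAt ℝ ∞ (fun z : ℂ => z / (‖z‖ : ℂ)) (f x) := by
      simp only [div_eq_mul_inv]
      exact contDiffAt_id.mul <| ContDiffAt.inv
        (Complex.ofRealCLM.contDiff.contDiffAt.comp _ (contDiffAt_norm ℝ (h0 x)))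
        (Complex.ofReal_ne_zero.2 (norm_ne_zero_iff.2 (h0 x)))
    exact h2.contMDiffAt.comp x (hf x)
  exact h1.codRestrict_sphere fun x => (unitPhase (f x) (h0 x)).2

theorem contMDiff_prod_zpow {E H M ι : Type*} [Fintype ι] [NormedAddCommGroup E]
    [NormedSpace ℝ E] [TopologicalSpace H] {I : ModelWithCorners ℝ E H} [TopologicalSpace M]
    [ChartedSpace H M] [IsManifold I ∞ M] {f : ι → M → Circle}
    (hf : ∀ i, ContMDiff I (𝓡 1) ∞ (f i)) (a : ι → ℤ) :
    ContMDiff I (𝓡 1) ∞ fun x => ∏ i, f i x ^ a i := by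
  have := finrank_real_complex_fact'
  have h1 : ContMDiff I 𝓘(ℝ, ℂ) ∞ fun x => ((∏ i, f i x ^ a i : Circle) : ℂ) := by
    have h2 : (fun x => ((∏ i, f i x ^ a i : Circle) : ℂ))
        = fun x => ∏ i, (f i x : ℂ) ^ a i := by
      ext x
      refine (map_prod Circle.coeHom _ _).trans ?_
      simp only [map_zpow]
      rfl
    rw [h2]
    intro x
    have h3 : ContMDiff I 𝓘(ℝ, ι → ℂ) ∞ fun x i => (f i x : ℂ) :=
      contMDiff_pi_space.2 fun i => contMDiff_circle_coe.comp (hf i)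
    have h4 : ContDiffAt ℝ ∞ (fun w : ι → ℂ => ∏ i, w i ^ a i) fun i => (f i x : ℂ) :=
      contDiffAt_prod_zpow a fun i => Circle.coe_ne_zero (f i x)
    have h5 := h4.contMDiffAt.comp x (h3 x)
    exact h5
  exact h1.codRestrict_sphere fun x => (∏ i, f i x ^ a i : Circle).2

/-- The torus coordinates of the inverse of `projE`. -/
noncomputable def angleCoord (m p : ℕ) (y : ℝ) (P : nonzeroCoords m) : Fin m → Circle :=
  fun k => ∏ j : Fin m, unitPhase (normCoord P j.castSucc) (normCoord_ne_zero P _) ^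
    (sgnM m p y * matA m p j k)

theorem contMDiff_angleCoord :
    ContMDiff 𝓘(ℝ, Fin m → ℂ) (ModelWithCorners.pi fun _ : Fin m => 𝓡 1) ∞
      (angleCoord m p y) := by
  have h : ∀ j : Fin m, ContMDiff 𝓘(ℝ, Fin m → ℂ) (𝓡 1) ∞ fun P : nonzeroCoords m =>
      unitPhase (normCoord P j.castSucc) (normCoord_ne_zero P _) :=
    fun j => contMDiff_unitPhase (contMDiff_normCoord j.castSucc) _
  refine contMDiff_pi_of_apply fun k => ?_
  exact contMDiff_prod_zpow h fun j => sgnM m p y * matA m p j k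

theorem sgnM_smul_mul_smul (hM : bigM m p y ≠ 0) (B C : Matrix (Fin m) (Fin m) ℤ) :
    (sgnM m p y • B) * (sgnM m p y • C) = B * C := by
  rw [smul_mul_smul_comm, sgnM_mul_self hM, one_smul]

/-- The exponent matrices sgn(M) Ω and sgn(M) Aᵀ are mutually inverse, since sgn(M)² = 1. -/
theorem phase_angleCoord (h : IsUnit (matA m p).det) (hM : bigM m p y ≠ 0)
    (P : nonzeroCoords m) (j : Fin (m + 1)) :
    phase p y (angleCoord m p y P) j = unitPhase (normCoord P j) (normCoord_ne_zero P j) := by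
  refine Fin.lastCases ?_ (fun j => ?_) j
  · ext
    simp [phase, coe_unitPhase, normCoord_last]
  · have hBC : (sgnM m p y • matOmega m p) * (sgnM m p y • (matA m p).transpose) = 1 := by
      rw [sgnM_smul_mul_smul hM, matOmega, ← Matrix.transpose_mul, Matrix.mul_nonsing_inv _ h,
        Matrix.transpose_one]
    have := prod_zpow_prod_zpow _ _ hBC
      (fun i : Fin m => unitPhase (normCoord P i.castSucc) (normCoord_ne_zero P _)) j
    simpa [phase, angleCoord] using this

theorem angle_of_phase (h : IsUnit (matA m p).det) (hM : bigM m p y ≠ 0)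
    (ζ : Fin m → Circle) (k : Fin m) :
    ∏ j : Fin m, phase p y ζ j.castSucc ^ (sgnM m p y * matA m p j k) = ζ k := by
  have hBC : (sgnM m p y • (matA m p).transpose) * (sgnM m p y • matOmega m p) = 1 := by
    rw [sgnM_smul_mul_smul hM, matOmega, ← Matrix.transpose_mul, Matrix.nonsing_inv_mul _ h,
      Matrix.transpose_one]
  have := prod_zpow_prod_zpow _ _ hBC ζ k
  simpa [phase] using this

theorem mapE_apply_ne_zero (hpos : ∀ x : PhaseSpace m p y, ∀ j, 0 < sqAbs p y x.1.1 j)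
    (x : PhaseSpace m p y) (j : Fin (m + 1)) : mapE m p y x j ≠ 0 := by
  have h := norm_mapE_sq x j
  intro h0
  rw [h0] at h
  simp at h
  exact (hpos x j).ne h

theorem projE_mem (hM : bigM m p y ≠ 0)
    (hpos : ∀ x : PhaseSpace m p y, ∀ j, 0 < sqAbs p y x.1.1 j) (x : PhaseSpace m p y) :
    projE m p y x ∈ nonzeroCoords m := fun j =>
  (proj_rep_ne_zero_iff (mapE_ne_zero hM x) j).2 (mapE_apply_ne_zero hpos x j)

/-- The last phase is 1, so normalizing by the last coordinate divides by a positive real and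
preserves every phase. -/
theorem normCoord_projE (hM : bigM m p y ≠ 0)
    (hpos : ∀ x : PhaseSpace m p y, ∀ j, 0 < sqAbs p y x.1.1 j) (x : PhaseSpace m p y)
    (j : Fin (m + 1)) :
    normCoord ⟨projE m p y x, projE_mem hM hpos x⟩ j
      = ((Real.sqrt (sqAbs p y x.1.1 j) / Real.sqrt (sqAbs p y x.1.1 (Fin.last m)) : ℝ) : ℂ)
        * phase p y x.2 j := by
  refine (proj_rep_div (mapE_ne_zero hM x) (Fin.last m) j).trans ?_
  simp [mapE, phase]
  ring

theorem actionCoord_projE (hM : bigM m p y ≠ 0)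
    (hpos : ∀ x : PhaseSpace m p y, ∀ j, 0 < sqAbs p y x.1.1 j) (x : PhaseSpace m p y)  :
    actionCoord m p y ⟨projE m p y x, projE_mem hM hpos x⟩ = sqAbs p y x.1.1 := by
  have h : ∀ j, ‖normCoord ⟨projE m p y x, projE_mem hM hpos x⟩ j‖ ^ 2
      = sqAbs p y x.1.1 j / sqAbs p y x.1.1 (Fin.last m) := by
    intro j
    rw [normCoord_projE hM hpos, norm_mul, Circle.norm_coe, mul_one, Complex.norm_real, Real.norm_eq_abs,
      sq_abs, div_pow, Real.sq_sqrt (hpos x j).le, Real.sq_sqrt (hpos x _).le]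
  ext j
  have h1 := (hpos x (Fin.last m)).ne'
  have h2 := abs_ne_zero.2 hM
  simp only [actionCoord, h, ← Finset.sum_div, sum_sqAbs]
  field_simp

theorem angleCoord_projE (h : IsUnit (matA m p).det) (hM : bigM m p y ≠ 0)
    (hpos : ∀ x : PhaseSpace m p y, ∀ j, 0 < sqAbs p y x.1.1 j) (x : PhaseSpace m p y) :
    angleCoord m p y ⟨projE m p y x, projE_mem hM hpos x⟩ = x.2 := by
  ext1 k
  rw [← angle_of_phase (p := p) (y := y) h hM x.2 k, angleCoord]
  refine Finset.prod_congr rfl fun j _ => ?_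
  congr 1
  simp only [normCoord_projE hM hpos]
  exact unitPhase_ofReal_mul (div_pos (Real.sqrt_pos.2 (hpos x _)) (Real.sqrt_pos.2 (hpos x _)))
    _ _

theorem solveXi_actionCoord_mem (h : IsUnit (matA m p).det) (hp : p ≤ m) (hM : bigM m p y ≠ 0)
    (P : nonzeroCoords m) : solveXi m p y (actionCoord m p y P) ∈ configSpace m p y := by
  refine (mem_configSpace_iff h hp hM).2 fun j => ?_
  rw [sqAbs_solveXi h hp hM (sum_actionCoord P)]
  exact actionCoord_pos hM P j

/-- The inverse of `projE`. -/
noncomputable def projEInv (h : IsUnit (matA m p).det) (hp : p ≤ m) (hM : bigM m p y ≠ 0)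
    (P : nonzeroCoords m) : PhaseSpace m p y :=
  (⟨solveXi m p y (actionCoord m p y P), solveXi_actionCoord_mem h hp hM P⟩,
    angleCoord m p y P)

theorem contMDiff_projEInv (h : IsUnit (matA m p).det) (hp : p ≤ m) (hM : bigM m p y ≠ 0) :
    ContMDiff 𝓘(ℝ, Fin m → ℂ) (phaseModel m) ∞ (projEInv h hp hM) := by
  refine ContMDiff.prodMk ?_ contMDiff_angleCoord
  refine (ContMDiff.subtypeVal_comp_iff _ _).1 ?_
  exact contDiff_solveXi.contMDiff.comp contMDiff_actionCoord

theorem projE_projEInv (h : IsUnit (matA m p).det) (hp : p ≤ m) (hM : bigM m p y ≠ 0)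
    (P : nonzeroCoords m) : projE m p y (projEInv h hp hM P) = P.1 := by
  -- The positive factor that scales the normalized representative to the sphere of squared radius
  -- |M|.
  set c : ℝ := Real.sqrt (|bigM m p y| / ∑ i, ‖normCoord P i‖ ^ 2) with hc
  have hc0 : (c : ℂ) ≠ 0 := Complex.ofReal_ne_zero.2
    (Real.sqrt_pos.2 (div_pos (abs_pos.2 hM) (sum_norm_normCoord_pos P))).ne'
  have hE : mapE m p y (projEInv h hp hM P) = (c : ℂ) • normCoord P := by
    ext j
    have h1 : sqAbs p y (projEInv h hp hM P).1.1 j = actionCoord m p y P j :=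
      sqAbs_solveXi h hp hM (sum_actionCoord P) j
    have h2 : phase p y (projEInv h hp hM P).2 j = _ := phase_angleCoord h hM P j
    have h3 : Real.sqrt (actionCoord m p y P j) = c * ‖normCoord P j‖ := by
      rw [actionCoord, mul_div_right_comm, Real.sqrt_mul (by positivity),
        Real.sqrt_sq (norm_nonneg _)]
    have h4 : (‖normCoord P j‖ : ℂ) ≠ 0 := by
      simpa using normCoord_ne_zero P j
    rw [mapE, h1, h2, h3, coe_unitPhase, Pi.smul_apply, smul_eq_mul, Complex.ofReal_mul]
    field_simp
  have h0 : normCoord P ≠ 0 := fun h0 => normCoord_ne_zero P 0 (congrFun h0 0)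
  rw [projE, hE, proj_smul hc0 h0, proj_normCoord]

/-- The diffeomorphism of the local phase space onto `nonzeroCoords m`. -/
noncomputable def projEDiffeomorph (h : IsUnit (matA m p).det) (hp : p ≤ m)
    (hM : bigM m p y ≠ 0) : Diffeomorph (phaseModel m) 𝓘(ℝ, Fin m → ℂ)
      (PhaseSpace m p y) (nonzeroCoords m) ∞ where
  toFun x := ⟨projE m p y x, projE_mem hM (sqAbs_pos h hp hM) x⟩
  invFun := projEInv h hp hM
  left_inv x := by
    refine Prod.ext (Subtype.ext ?_) (angleCoord_projE h hM (sqAbs_pos h hp hM) x)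
    simp only [projEInv]
    rw [actionCoord_projE hM (sqAbs_pos h hp hM) x, solveXi_sqAbs h hp hM]
  right_inv P := Subtype.ext (projE_projEInv h hp hM P)
  contMDiff_toFun :=
    (ContMDiff.subtypeVal_comp_iff _ _).1 (contMDiff_projE hM (sqAbs_pos h hp hM))
  contMDiff_invFun := contMDiff_projEInv h hp hM

end Inverse

end RSProj

theorem mainTheorem3 (m p q : ℕ) (y : ℝ) (hm : 1 ≤ m)
    (hp : 1 ≤ p ∧ p ≤ m) (hcop : Nat.Coprime (m + 1) p)
    (hq : 1 ≤ q ∧ q ≤ m) (hpq : p * q ≡ 1 [MOD (m + 1)])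
    (hy : (((p : ℝ) / (m + 1) - 1 / ((m + 1) * q)) * Real.pi < y ∧
            y < p * Real.pi / (m + 1)) ∨
          (p * Real.pi / (m + 1) < y ∧
            y < ((p : ℝ) / (m + 1) + 1 / (((m : ℝ) + 1 - q) * (m + 1))) * Real.pi)) :
    -- the closed simplex lies in the interior of the Weyl alcove
    (∀ x ∈ RSProj.simplex m p y, ∀ k, 0 < RSProj.fullXi x k) ∧
    -- `ℰ` takes its values in the sphere of squared radius `|M|`
    (∀ x : RSProj.PhaseSpace m p y,
      ∑ j, ‖RSProj.mapE m p y x j‖ ^ 2 = |RSProj.bigM m p y|) ∧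
    -- on that sphere, `|M|` times the Fubini--Study form pulls back to `i Σ dū_j ∧ du_j`
    (∀ u : Fin (m + 1) → ℂ, ∑ j, ‖u j‖ ^ 2 = |RSProj.bigM m p y| →
      ∀ v : Fin 2 → (Fin (m + 1) → ℂ),
        (∀ a, ∑ j, ((starRingEnd ℂ) (u j) * v a j).re = 0) →
        |RSProj.bigM m p y| * RSProj.fubiniStudy (RSProj.proj u)
          (fun a => mfderiv 𝓘(ℝ, Fin (m + 1) → ℂ) 𝓘(ℝ, Fin m → ℂ) RSProj.proj u (v a))
          = RSProj.stdForm m v) ∧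
    -- smoothness, injectivity and the image
    ContMDiff (RSProj.phaseModel m) 𝓘(ℝ, Fin m → ℂ) ∞ (RSProj.projE m p y) ∧
    Function.Injective (RSProj.projE m p y) ∧
    Set.range (RSProj.projE m p y) = (RSProj.nonzeroCoords m : Set (RSProj.CP m)) ∧
    IsOpen (RSProj.nonzeroCoords m : Set (RSProj.CP m)) ∧
    Dense (RSProj.nonzeroCoords m : Set (RSProj.CP m)) ∧
    -- the symplectic property
    (∀ x : RSProj.PhaseSpace m p y,
      (|RSProj.bigM m p y| • RSProj.fubiniStudy (RSProj.projE m p y x)).compContinuousLinearMap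
        (mfderiv (RSProj.phaseModel m) 𝓘(ℝ, Fin m → ℂ) (RSProj.projE m p y) x)
        = RSProj.omegaLoc x) ∧
    -- it is a diffeomorphism onto its image
    ∃ Φ : Diffeomorph (RSProj.phaseModel m) 𝓘(ℝ, Fin m → ℂ)
        (RSProj.PhaseSpace m p y) (RSProj.nonzeroCoords m) ∞,
      ∀ x, (Φ x : RSProj.CP m) = RSProj.projE m p y x := by
  have hpm := hp.2
  -- The number r of full turns enters both the unimodularity of A and the positivity of ξ.
  obtain ⟨r, hr⟩ : ∃ r, p * q = (m + 1) * r + 1 := by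
    obtain ⟨r, hr⟩ := (Nat.modEq_iff_dvd' (Nat.mul_pos hp.1 hq.1)).1 hpq.symm
    exact ⟨r, by have := Nat.mul_pos hp.1 hq.1; omega⟩
  have hdet : IsUnit (RSProj.matA m p).det := RSProj.isUnit_det_matA hpm hr
  have hM : RSProj.bigM m p y ≠ 0 := RSProj.bigM_ne_zero hy
  let Φ := RSProj.projEDiffeomorph hdet hpm hM
  have hΦ : ∀ x, (Φ x : RSProj.CP m) = RSProj.projE m p y x := fun _ => rfl
  refine ⟨fun x hx k => RSProj.fullXi_pos hr hpm hq.2 hq.1 hy hx k,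
    RSProj.sum_norm_mapE_sq, fun u hu v hv => ?_,
    RSProj.contMDiff_projE hM (RSProj.sqAbs_pos hdet hpm hM), fun x x' hxx => ?_, ?_,
    (RSProj.nonzeroCoords m).isOpen, RSProj.dense_nonzeroCoords,
    RSProj.fubiniStudy_pullback_projE hdet hpm hM, Φ, hΦ⟩
  · refine RSProj.fubiniStudy_pullback_sphere (fun h0 => ?_) hu v hv
    rw [h0] at hu
    simp at hu
    exact hM (abs_eq_zero.1 hu.symm)
  · exact Φ.injective (Subtype.ext hxx)
  · ext P
    constructor
    · rintro ⟨x, rfl⟩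
      exact (Φ x).2
    · intro hP
      obtain ⟨x, hx⟩ := Φ.surjective ⟨P, hP⟩
      exact ⟨x, congrArg Subtype.val hx⟩
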